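/- Let $k$ be a field of characteristic $p>0$, let $X$ be a smooth variety over $k$ (an integral scheme, smooth, separated and of finite type over $k$), and let $f\in\mathcal O(X)$ be a nonconstant function, i.e. $f\notin k$. Then every root of the $b$-function $b_f$ of $f$, a priori a $p$-adic integer, is a rational number $q$ with $-1\le q<0$. Here $b_f$ and its roots are defined as follows. For a commutative $k$-algebra $A$, let $D_A$ be the ring of Grothendieck differential operators of $A$ over $k$. Let $\nu_e=\partial_t^{[p^e]}t^{p^e}\in D_{k[t]}$ $(e\ge 0)$ be the higher Euler operators, put $\binom{s}{p^e}:=-\nu_e$, and let $\mathcal E=k[\nu_e;\,e\ge 0]\subset D_{k[t]}$ be the (commutative) subalgebra they generate. * If $X=\operatorname{Spec}R$ is affine, $D_{R[t]}$ acts on $B_f=R[t]_{f-t}/R[t]$. Let $\delta\in B_f$ be the class of $\frac1{f-t}$, $M_f=D_R[\nu_e;\,e\ge0]\,\delta\subset B_f$ and $N_f=M_f/tM_f$. In general, $M_f$, $tM_f$ and $N_f$ are defined on $X$ by gluing these over the affine open subsets of $X$. The $b$-function $b_f$ is the ideal of $\mathcal E$ that annihilates $N_f$. * A maximal ideal $\mathfrak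 m$ of $\mathcal E$ corresponds to the $p$-adic integer $\alpha=\sum_{e\ge0}\alpha_ep^e$, $\alpha_e\in\{0,\dots,p-1\}$, such that $\binom{s}{p^e}\equiv\alpha_e \pmod{\mathfrak m}$ for all $e$. The roots of an ideal $I\subset\mathcal E$ are the $p$-adic integers corresponding to the maximal ideals that contain $I$. -/

import Mathlib

set_option linter.unusedSectionVars false

open Polynomial AlgebraicGeometry CategoryTheory

universe u

noncomputable section

namespace CharPBFunction

/-! ### Grothendieck differential operators -/

section DifferentialOperators

/-- The commutator `[P, a] = P ∘ a - a ∘ P` of a `k`-linear endomorphism `P` of `A` with the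
multiplication by `a`. -/
def comm {k A : Type*} [CommRing k] [CommRing A] [Algebra k A]
    (P : Module.End k A) (a : A) : Module.End k A :=
  P * Algebra.lmul k A a - Algebra.lmul k A a * P

theorem comm_apply {k A : Type*} [CommRing k] [CommRing A] [Algebra k A]
    (P : Module.End k A) (a x : A) : comm P a x = P (a * x) - a * P x := rfl

/-- Grothendieck's differential operators of order `< n` on the `k`-algebra `A`: only `0` has order
`< 0`, and `P` has order `< n + 1` if `[P, a]` has order `< n` for all `a ∈ A`. -/
def diffOpLT (k A : Type*) [CommRing k] [CommRing A] [Algebra k A] :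
    ℕ → Submodule A (Module.End k A)
  | 0 => ⊥
  | n + 1 =>
    { carrier := {P | ∀ a : A, comm P a ∈ diffOpLT k A n}
      add_mem' := by
        intro P Q hP hQ a
        have h : comm (P + Q) a = comm P a + comm Q a := by
          ext x; simp only [comm_apply, LinearMap.add_apply]; ring
        rw [h]; exact add_mem (hP a) (hQ a)
      zero_mem' := by
        intro a
        have h : comm (0 : Module.End k A) a = 0 := by
          ext x; simp [comm_apply]
        rw [h]; exact zero_mem _
      smul_mem' := by
        intro b P hP a
        have h : comm (b • P) a = b • comm P a := by
          ext x; simp only [comm_apply, LinearMap.smul_apply, smul_eq_mul]; ring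
        rw [h]; exact Submodule.smul_mem _ b (hP a) }

variable {k A : Type*} [CommRing k] [CommRing A] [Algebra k A]

theorem mem_diffOpLT_zero {P : Module.End k A} : P ∈ diffOpLT k A 0 ↔ P = 0 := Iff.rfl

theorem mem_diffOpLT_succ {n : ℕ} {P : Module.End k A} :
    P ∈ diffOpLT k A (n + 1) ↔ ∀ a : A, comm P a ∈ diffOpLT k A n := Iff.rfl

theorem diffOpLT_le_succ (n : ℕ) : diffOpLT k A n ≤ diffOpLT k A (n + 1) := by
  induction n with
  | zero => intro P hP; rw [mem_diffOpLT_zero.1 hP]; exact zero_mem _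
  | succ n ih => intro P hP a; exact ih (hP a)

theorem diffOpLT_mono : Monotone (diffOpLT k A) := monotone_nat_of_le_succ diffOpLT_le_succ

theorem diffOpLT_mul (N : ℕ) : ∀ (m n : ℕ) (P Q : Module.End k A), m + n = N →
    P ∈ diffOpLT k A m → Q ∈ diffOpLT k A n → P * Q ∈ diffOpLT k A N := by
  induction N with
  | zero =>
    intro m n P Q h hP hQ
    obtain rfl : m = 0 := by omega
    rw [mem_diffOpLT_zero.1 hP, zero_mul]; exact zero_mem _
  | succ N ih =>
    intro m n P Q h hP hQ
    rcases m with _ | m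
    · rw [mem_diffOpLT_zero.1 hP, zero_mul]; exact zero_mem _
    rcases n with _ | n
    · rw [mem_diffOpLT_zero.1 hQ, mul_zero]; exact zero_mem _
    intro a
    have e : comm (P * Q) a = P * comm Q a + comm P a * Q := by
      ext x; simp only [comm_apply, LinearMap.add_apply, Module.End.mul_apply, map_sub]; ring
    rw [e]
    exact add_mem (ih (m + 1) n _ _ (by omega) hP (hQ a)) (ih m (n + 1) _ _ (by omega) (hP a) hQ)

theorem lmul_mem_diffOpLT (a : A) : Algebra.lmul k A a ∈ diffOpLT k A 1 := by
  intro b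
  rw [mem_diffOpLT_zero]
  ext x
  simp only [comm_apply, Algebra.coe_lmul_eq_mul, LinearMap.mul_apply', LinearMap.zero_apply]
  ring

variable (k A) in
/-- The ring `D_A` of Grothendieck differential operators of the `k`-algebra `A`. -/
def diffOp : Subalgebra k (Module.End k A) where
  carrier := {P | ∃ n, P ∈ diffOpLT k A n}
  mul_mem' := by
    rintro P Q ⟨m, hP⟩ ⟨n, hQ⟩
    exact ⟨m + n, diffOpLT_mul _ m n P Q rfl hP hQ⟩
  add_mem' := by
    rintro P Q ⟨m, hP⟩ ⟨n, hQ⟩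
    exact ⟨max m n, add_mem (diffOpLT_mono (le_max_left m n) hP)
      (diffOpLT_mono (le_max_right m n) hQ)⟩
  algebraMap_mem' := by
    intro c
    refine ⟨1, ?_⟩
    have h : algebraMap k (Module.End k A) c = Algebra.lmul k A (algebraMap k A c) := by
      ext x; simp [Algebra.smul_def]
    rw [h]; exact lmul_mem_diffOpLT _

theorem mem_diffOp {P : Module.End k A} : P ∈ diffOp k A ↔ ∃ n, P ∈ diffOpLT k A n := Iff.rfl

/-- The multiplication by `a ∈ A`, as a differential operator. -/
def mulOp (k : Type*) {A : Type*} [CommRing k] [CommRing A] [Algebra k A] (a : A) : diffOp k A :=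
  ⟨Algebra.lmul k A a, 1, lmul_mem_diffOpLT a⟩

end DifferentialOperators

/-! ### Extension of differential operators to a localization, in characteristic `p` -/

section Localization

variable {k A : Type*} [CommRing k] [CommRing A] [Algebra k A]

theorem pow_mulRight_sub_mulLeft_mem (a : A) {n : ℕ} {P : Module.End k A}
    (hP : P ∈ diffOpLT k A n) (j : ℕ) :
    ((LinearMap.mulRight k (Algebra.lmul k A a) - LinearMap.mulLeft k (Algebra.lmul k A a)) ^ j) P
      ∈ diffOpLT k A (n - j) := by
  induction j with
  | zero => simpa using hP
  | succ j ih =>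
    rw [pow_succ', Module.End.mul_apply]
    set Q := ((LinearMap.mulRight k (Algebra.lmul k A a)
      - LinearMap.mulLeft k (Algebra.lmul k A a)) ^ j) P
    change comm Q a ∈ _
    rcases h : n - j with _ | m
    · rw [h] at ih
      have : comm Q a = 0 := by
        rw [mem_diffOpLT_zero.1 ih]; ext x; simp [comm_apply]
      rw [this]; exact zero_mem _
    · rw [h] at ih
      have : n - (j + 1) = m := by omega
      rw [this]; exact ih a

/-- In characteristic `p`, a differential operator of order `< n` is linear over `p ^ e`-th powers
once `n ≤ p ^ e`. -/
theorem apply_pow_mul (p : ℕ) [Fact p.Prime] [CharP k p] {n e : ℕ}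
    (hn : n ≤ p ^ e) {P : Module.End k A} (hP : P ∈ diffOpLT k A n) (a x : A) :
    P (a ^ p ^ e * x) = a ^ p ^ e * P x := by
  rcases subsingleton_or_nontrivial A with hA | hA
  · exact Subsingleton.elim _ _
  have h := pow_mulRight_sub_mulLeft_mem a hP (p ^ e)
  rw [Nat.sub_eq_zero_of_le hn, mem_diffOpLT_zero] at h
  have hp : (p : Module.End k (Module.End k A)) = 0 := by
    rw [← map_natCast (algebraMap k (Module.End k (Module.End k A))), CharP.cast_eq_zero, map_zero]
  have : Nontrivial (Module.End k (Module.End k A)) := inferInstance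
  have : CharP (Module.End k (Module.End k A)) p := by
    obtain ⟨q, hq⟩ := CharP.exists (Module.End k (Module.End k A))
    have hd : q ∣ p := (CharP.cast_eq_zero_iff _ q p).1 hp
    rcases (Nat.dvd_prime (Fact.out : p.Prime)).1 hd with h1 | h1
    · subst h1
      have h1 := hq.cast_eq_zero
      rw [Nat.cast_one] at h1
      exact absurd h1 one_ne_zero
    · exact h1 ▸ hq
  have key := sub_pow_char_pow_of_commute (R := Module.End k (Module.End k A)) (p := p) (n := e)
    (LinearMap.commute_mulLeft_right (R := k) (Algebra.lmul k A a) (Algebra.lmul k A a)).symm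
  have h1 : (LinearMap.mulRight k (Algebra.lmul k A a) ^ p ^ e
      - LinearMap.mulLeft k (Algebra.lmul k A a) ^ p ^ e) P = 0 := by
    rw [← h]; exact congrArg (fun T : Module.End k (Module.End k A) => T P) key.symm
  rw [LinearMap.pow_mulRight, LinearMap.pow_mulLeft, ← map_pow] at h1
  exact sub_eq_zero.1 (congrArg (fun T : Module.End k A => T x) h1)

variable {L : Type*} [CommRing L] [Algebra A L] [Algebra k L] [IsScalarTower k A L]

theorem algebraMap_smul_eq (c : k) (a : A) : algebraMap A L (c • a) = c • algebraMap A L a := by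
  rw [Algebra.smul_def, Algebra.smul_def, map_mul, ← IsScalarTower.algebraMap_apply]

/-- `Q` is an operator on `L` extending the operator `P` on `A` along `A → L`. -/
def Extends (P : Module.End k A) (Q : Module.End k L) : Prop :=
  ∀ a : A, Q (algebraMap A L a) = algebraMap A L (P a)

theorem isUnit_algebraMap_pow (s : A) [IsLocalization.Away s L] (n : ℕ) :
    IsUnit (algebraMap A L s ^ n) :=
  (IsLocalization.Away.algebraMap_isUnit s).pow n

theorem exists_mul_pow_eq (s : A) [IsLocalization.Away s L] (q : ℕ) (hq : 0 < q) (x : L) :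
    ∃ (m : ℕ) (a : A), x * algebraMap A L s ^ (q * m) = algebraMap A L a := by
  obtain ⟨m, a, h⟩ := IsLocalization.Away.surj s x
  obtain ⟨q, rfl⟩ : ∃ r, q = r + 1 := ⟨q - 1, by omega⟩
  refine ⟨m, a * s ^ (q * m), ?_⟩
  rw [map_mul, ← h, map_pow, add_mul, one_mul, add_comm, pow_add, mul_assoc]

/-- An operator `P` which is linear over `q`-th powers extends to a localization. -/
theorem exists_extends_of_linear (s : A) [IsLocalization.Away s L] (q : ℕ) (hq : 0 < q)
    (P : Module.End k A) (hP : ∀ a x : A, P (a ^ q * x) = a ^ q * P x) :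
    ∃ Q : Module.End k L, Extends P Q ∧
      ∀ x, Q (algebraMap A L s ^ q * x) = algebraMap A L s ^ q * Q x := by
  have key : ∀ (m m' : ℕ) (a a' : A),
      algebraMap A L a * algebraMap A L s ^ (q * m') = algebraMap A L a' * algebraMap A L s ^ (q * m) →
      algebraMap A L (P a) * algebraMap A L s ^ (q * m') =
        algebraMap A L (P a') * algebraMap A L s ^ (q * m) := by
    intro m m' a a' h
    rw [← map_pow, ← map_pow, ← map_mul, ← map_mul] at h
    obtain ⟨c, hc⟩ := IsLocalization.Away.exists_of_eq s h
    have e : ∀ (n : ℕ) (b : A), P (s ^ (q * c) * (b * s ^ (q * n))) =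
        s ^ (q * c) * (P b * s ^ (q * n)) := by
      intro n b
      rw [mul_comm b, mul_comm q c, mul_comm q n, pow_mul, pow_mul, hP, hP, mul_comm (P b)]
    have h2 : s ^ (q * c) * (a * s ^ (q * m')) = s ^ (q * c) * (a' * s ^ (q * m)) := by
      obtain ⟨r, rfl⟩ : ∃ r, q = r + 1 := ⟨q - 1, by omega⟩
      have : s ^ ((r + 1) * c) = s ^ (r * c) * s ^ c := by rw [← pow_add]; ring
      rw [this, mul_assoc, mul_assoc, hc]
    have h3 := congrArg P h2
    rw [e, e] at h3
    have h4 := congrArg (algebraMap A L) h3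
    simp only [map_mul, map_pow] at h4
    exact (isUnit_algebraMap_pow s _).mul_left_cancel h4
  choose m a hma using exists_mul_pow_eq (L := L) s q hq
  have hF : ∀ x : L, ∃ y : L, y * algebraMap A L s ^ (q * m x) = algebraMap A L (P (a x)) := by
    intro x
    obtain ⟨u, hu⟩ := isUnit_algebraMap_pow (L := L) s (q * m x)
    exact ⟨algebraMap A L (P (a x)) * ↑u⁻¹, by rw [← hu, mul_assoc, Units.inv_mul, mul_one]⟩
  choose F hFs using hF
  have spec : ∀ (x : L) (n : ℕ) (b : A), x * algebraMap A L s ^ (q * n) = algebraMap A L b →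
      F x * algebraMap A L s ^ (q * n) = algebraMap A L (P b) := by
    intro x n b h
    have h1 := key (m x) n (a x) b (by rw [← hma, ← h]; ring)
    rw [← hFs] at h1
    apply (isUnit_algebraMap_pow (L := L) s (q * m x)).mul_right_cancel
    rw [← h1]; ring
  have cancel : ∀ (n : ℕ) (y z : L), y * algebraMap A L s ^ (q * n) = z * algebraMap A L s ^ (q * n) →
      y = z := fun n y z h => (isUnit_algebraMap_pow (L := L) s (q * n)).mul_right_cancel h
  refine ⟨{ toFun := F, map_add' := ?_, map_smul' := ?_ }, ?_, ?_⟩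
  · intro x y
    apply cancel (m x + m y)
    rw [spec (x + y) (m x + m y) (a x * s ^ (q * m y) + a y * s ^ (q * m x)) (by
      rw [map_add, map_mul, map_mul, ← hma, ← hma, map_pow, map_pow]; ring)]
    have e : ∀ (n : ℕ) (b : A), P (b * s ^ (q * n)) = s ^ (q * n) * P b := by
      intro n b
      rw [mul_comm b, mul_comm q n, pow_mul, hP]
    rw [map_add P, e, e, map_add, map_mul, map_mul, ← hFs, ← hFs, map_pow, map_pow]
    ring
  · intro c x
    apply cancel (m x)
    rw [spec (c • x) (m x) (c • a x) (by
      rw [smul_mul_assoc, hma, algebraMap_smul_eq]), map_smul, algebraMap_smul_eq, ← hFs,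
      RingHom.id_apply, smul_mul_assoc]
  · intro b
    have := spec (algebraMap A L b) 0 b (by simp)
    simpa using this
  · intro x
    apply cancel (m x)
    change F _ * _ = _ * F x * _
    rw [spec (algebraMap A L s ^ q * x) (m x) (s ^ q * a x) (by
      rw [mul_assoc, hma, map_mul, map_pow]), hP, map_mul, mul_assoc, hFs, map_pow]

theorem mem_diffOpLT_of_extends (s : A) [IsLocalization.Away s L] (q : ℕ) (hq : 0 < q) (n : ℕ) :
    ∀ (P : Module.End k A) (Q : Module.End k L), P ∈ diffOpLT k A n → Extends P Q →
      (∀ x, Q (algebraMap A L s ^ q * x) = algebraMap A L s ^ q * Q x) →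
      Q ∈ diffOpLT k L n := by
  have hmul : ∀ Q : Module.End k L,
      (∀ x, Q (algebraMap A L s ^ q * x) = algebraMap A L s ^ q * Q x) →
      ∀ m x, Q (algebraMap A L s ^ (q * m) * x) = algebraMap A L s ^ (q * m) * Q x := by
    intro Q hQ m
    induction m with
    | zero => simp
    | succ m ih =>
      intro x
      rw [mul_add, mul_one, pow_add, mul_assoc, ih, hQ, mul_assoc]
  induction n with
  | zero =>
    intro P Q hP hPQ hQ
    rw [mem_diffOpLT_zero] at hP ⊢
    subst hP
    ext x
    obtain ⟨m, a, h⟩ := exists_mul_pow_eq s q hq x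
    apply (isUnit_algebraMap_pow (L := L) s (q * m)).mul_left_cancel
    rw [← hmul Q hQ, mul_comm, h, hPQ]; simp
  | succ n ih =>
    intro P Q hP hPQ hQ x
    obtain ⟨m, a, h⟩ := exists_mul_pow_eq s q hq x
    have h1 : comm Q (algebraMap A L a) ∈ diffOpLT k L n := by
      refine ih (comm P a) _ (hP a) ?_ ?_
      · intro b
        rw [comm_apply, comm_apply, ← map_mul, hPQ, hPQ, map_sub, map_mul (algebraMap A L) a (P b)]
      · intro y
        rw [comm_apply, comm_apply, mul_left_comm, hQ, hQ]; ring
    obtain ⟨u, hu⟩ := isUnit_algebraMap_pow (L := L) s (q * m)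
    have h2 : comm Q x = (↑u⁻¹ : L) • comm Q (algebraMap A L a) := by
      ext y
      rw [LinearMap.smul_apply, smul_eq_mul, comm_apply, comm_apply]
      apply u.isUnit.mul_left_cancel
      rw [Units.mul_inv_cancel_left, mul_sub, ← h, hu, ← hmul Q hQ]
      congr 1
      · congr 1; ring
      · ring
    rw [h2]
    exact Submodule.smul_mem _ _ h1

/-- A differential operator on `A` extends uniquely to a differential operator on `A[1/s]`. -/
theorem existsUnique_extends (p : ℕ) [Fact p.Prime] [CharP k p] (s : A) [IsLocalization.Away s L]
    (P : diffOp k A) : ∃! Q : diffOp k L, Extends P.1 Q.1 := by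
  obtain ⟨P, n, hP⟩ := P
  have hpos : ∀ e, 0 < p ^ e := fun e => pow_pos (Fact.out : p.Prime).pos e
  have hle : n ≤ p ^ n := (Nat.lt_pow_self (Fact.out : p.Prime).one_lt).le
  obtain ⟨Q, hPQ, hQ⟩ := exists_extends_of_linear (L := L) s (p ^ n) (hpos n) P
    (fun a x => apply_pow_mul p hle hP a x)
  refine ⟨⟨Q, n, mem_diffOpLT_of_extends s (p ^ n) (hpos n) n P Q hP hPQ hQ⟩, hPQ, ?_⟩
  have hQm := mem_diffOpLT_of_extends s (p ^ n) (hpos n) n P Q hP hPQ hQ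
  rintro ⟨Q', n', hQ'⟩ hPQ'
  apply Subtype.ext
  change Q' = Q
  have hle' : max n n' ≤ p ^ max n n' := (Nat.lt_pow_self (Fact.out : p.Prime).one_lt).le
  ext x
  obtain ⟨m, a, h⟩ := exists_mul_pow_eq s (p ^ max n n') (hpos _) x
  apply (isUnit_algebraMap_pow (L := L) s (p ^ max n n' * m)).mul_left_cancel
  have e : ∀ T : Module.End k L, T ∈ diffOpLT k L (max n n') →
      algebraMap A L s ^ (p ^ max n n' * m) * T x = T (algebraMap A L a) := by
    intro T hT
    rw [← h, mul_comm x, mul_comm (p ^ max n n') m, pow_mul, apply_pow_mul p hle' hT]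
  rw [e Q' (diffOpLT_mono (le_max_right _ _) hQ'), e Q (diffOpLT_mono (le_max_left _ _) hQm),
    hPQ a, hPQ' a]

/-- The action of `D_A` on the localization `L = A[1/s]`: an operator on `A` acts through the unique
differential operator on `L` that extends it. -/
def extend (p : ℕ) [Fact p.Prime] [CharP k p] (s : A) [IsLocalization.Away s L] :
    diffOp k A →ₐ[k] diffOp k L :=
  AlgHom.ofLinearMap
    { toFun := fun P => (existsUnique_extends (L := L) p s P).choose
      map_add' := by
        intro P P'
        refine ((existsUnique_extends (L := L) p s (P + P')).choose_spec.2 _ ?_).symm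
        intro a
        have h := (existsUnique_extends (L := L) p s P).choose_spec.1 a
        have h' := (existsUnique_extends (L := L) p s P').choose_spec.1 a
        simp only [Subalgebra.coe_add, LinearMap.add_apply, map_add, h, h']
      map_smul' := by
        intro c P
        refine ((existsUnique_extends (L := L) p s (c • P)).choose_spec.2 _ ?_).symm
        intro a
        have h := (existsUnique_extends (L := L) p s P).choose_spec.1 a
        simp only [Subalgebra.coe_smul, LinearMap.smul_apply, RingHom.id_apply, h,
          algebraMap_smul_eq] }
    (by
      refine ((existsUnique_extends (L := L) p s 1).choose_spec.2 _ ?_).symm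
      intro a; simp)
    (by
      intro P P'
      refine ((existsUnique_extends (L := L) p s (P * P')).choose_spec.2 _ ?_).symm
      intro a
      have h := (existsUnique_extends (L := L) p s P).choose_spec.1
      have h' := (existsUnique_extends (L := L) p s P').choose_spec.1 a
      simp only [Subalgebra.coe_mul, LinearMap.coe_mk, AddHom.coe_mk, Module.End.mul_apply, h']
      exact h _)

theorem extend_extends (p : ℕ) [Fact p.Prime] [CharP k p] (s : A) [IsLocalization.Away s L]
    (P : diffOp k A) : Extends P.1 (extend (L := L) p s P).1 :=
  (existsUnique_extends (L := L) p s P).choose_spec.1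

end Localization

/-! ### Operators on `R[t]` induced by operators on `R` and on `k[t]` -/

section PolynomialRing

variable {k R : Type*} [CommRing k] [CommRing R] [Algebra k R]

/-- An operator on `R` acts on `R[t]` coefficientwise. -/
def coeffEnd (P : Module.End k R) : Module.End k R[X] where
  toFun g := ∑ n ∈ g.support, monomial n (P (g.coeff n))
  map_add' := by
    intro g h
    ext i
    simp only [finsetSum_coeff, coeff_monomial, Finset.sum_ite_eq', mem_support_iff, coeff_add]
    split_ifs <;> simp_all
    · rw [← map_add]; simp_all
  map_smul' := by
    intro c g
    ext i
    simp only [finsetSum_coeff, coeff_monomial, Finset.sum_ite_eq', mem_support_iff, coeff_smul]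
    split_ifs <;> simp_all
    · rw [← map_smul]; simp_all

theorem coeff_coeffEnd (P : Module.End k R) (g : R[X]) (i : ℕ) :
    (coeffEnd P g).coeff i = P (g.coeff i) := by
  change (∑ n ∈ g.support, monomial n (P (g.coeff n))).coeff i = _
  simp only [finsetSum_coeff, coeff_monomial, Finset.sum_ite_eq', mem_support_iff]
  split_ifs <;> simp_all

theorem coeffEnd_mem {n : ℕ} : ∀ {P : Module.End k R}, P ∈ diffOpLT k R n →
    coeffEnd P ∈ diffOpLT k R[X] n := by
  induction n with
  | zero =>
    intro P hP
    rw [mem_diffOpLT_zero] at hP ⊢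
    ext g i
    simp [coeff_coeffEnd, hP]
  | succ n ih =>
    intro P hP g
    induction g using Polynomial.induction_on' with
    | add g h hg hh =>
      have e : comm (coeffEnd P) (g + h) = comm (coeffEnd P) g + comm (coeffEnd P) h := by
        ext x i; simp only [comm_apply, LinearMap.add_apply, add_mul, map_add]; ring_nf
      rw [e]; exact add_mem hg hh
    | monomial j r =>
      have e : comm (coeffEnd P) (monomial j r) = (X ^ j : R[X]) • coeffEnd (comm P r) := by
        ext x i
        rw [LinearMap.smul_apply, smul_eq_mul, comm_apply, coeff_sub, coeff_coeffEnd,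
          ← C_mul_X_pow_eq_monomial, mul_assoc, mul_assoc, coeff_C_mul, coeff_C_mul, coeff_X_pow_mul',
          coeff_X_pow_mul', coeff_X_pow_mul']
        split_ifs
        · rw [coeff_coeffEnd, coeff_coeffEnd, comm_apply]
        · simp
      rw [e]; exact Submodule.smul_mem _ _ (ih (hP r))

/-- The inclusion `D_R → D_{R[t]}`. -/
def coeffOp (P : diffOp k R) : diffOp k R[X] :=
  ⟨coeffEnd P.1, P.2.choose, coeffEnd_mem P.2.choose_spec⟩

variable (R) in
/-- The `R`-linear extension to `R[t]` of an operator on `k[t]`. -/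
def baseChangeEnd (P : Module.End k k[X]) : R[X] →ₗ[R] R[X] :=
  (basisMonomials R).constr R fun n => (P (X ^ n)).map (algebraMap k R)

theorem baseChangeEnd_monomial (P : Module.End k k[X]) (n : ℕ) (r : R) :
    baseChangeEnd R P (monomial n r) = C r * (P (X ^ n)).map (algebraMap k R) := by
  have h : baseChangeEnd R P (basisMonomials R n) = (P (X ^ n)).map (algebraMap k R) :=
    Module.Basis.constr_basis _ _ _ _
  rw [coe_basisMonomials] at h
  rw [← smul_eq_C_mul, ← h, ← map_smul, smul_monomial, smul_eq_mul, mul_one]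

theorem baseChangeEnd_C_mul (P : Module.End k k[X]) (r : R) (g : R[X]) :
    baseChangeEnd R P (C r * g) = C r * baseChangeEnd R P g := by
  rw [← smul_eq_C_mul, map_smul, smul_eq_C_mul]

theorem baseChangeEnd_map (P : Module.End k k[X]) (g : k[X]) :
    baseChangeEnd R P (g.map (algebraMap k R)) = (P g).map (algebraMap k R) := by
  induction g using Polynomial.induction_on' with
  | add g h hg hh => rw [Polynomial.map_add, map_add, hg, hh, map_add, Polynomial.map_add]
  | monomial n c =>
    have h : monomial n c = c • (X ^ n : k[X]) := by
      rw [← C_mul_X_pow_eq_monomial, smul_eq_C_mul]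
    rw [map_monomial, baseChangeEnd_monomial, h, map_smul, smul_eq_C_mul, Polynomial.map_mul, map_C]

theorem baseChangeEnd_unique (P : Module.End k k[X]) (T : R[X] →ₗ[R] R[X])
    (h : ∀ n, T (X ^ n) = (P (X ^ n)).map (algebraMap k R)) : baseChangeEnd R P = T := by
  ext n : 2
  rw [LinearMap.comp_apply, LinearMap.comp_apply, baseChangeEnd_monomial, C_1, one_mul, ← h,
    monomial_one_right_eq_X_pow]

variable (R) in
/-- `R`-linear extension of operators, as a morphism of `k`-algebras. -/
def baseChangeAlgHom : Module.End k k[X] →ₐ[k] Module.End k R[X] :=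
  AlgHom.ofLinearMap
    { toFun := fun P => (baseChangeEnd R P).restrictScalars k
      map_add' := by
        intro P Q
        rw [baseChangeEnd_unique (P + Q) (baseChangeEnd R P + baseChangeEnd R Q)]
        · rfl
        · intro n
          rw [LinearMap.add_apply, LinearMap.add_apply, Polynomial.map_add, ← baseChangeEnd_map,
            ← baseChangeEnd_map, Polynomial.map_pow, map_X]
      map_smul' := by
        intro c P
        ext g : 1
        have h : baseChangeEnd R (c • P) = algebraMap k R c • baseChangeEnd R P := by
          apply baseChangeEnd_unique
          intro n
          rw [LinearMap.smul_apply, LinearMap.smul_apply, smul_eq_C_mul, smul_eq_C_mul,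
            Polynomial.map_mul, map_C, ← baseChangeEnd_map, Polynomial.map_pow, map_X]
        simp [h] }
    (by
      ext g : 1
      have h : baseChangeEnd R (1 : Module.End k k[X]) = LinearMap.id := by
        apply baseChangeEnd_unique
        intro n; simp
      simp [h])
    (by
      intro P Q
      ext g : 1
      have h : baseChangeEnd R (P * Q) = baseChangeEnd R P ∘ₗ baseChangeEnd R Q := by
        apply baseChangeEnd_unique
        intro n
        rw [LinearMap.comp_apply, Module.End.mul_apply, ← baseChangeEnd_map, ← baseChangeEnd_map,
          Polynomial.map_pow, map_X]
      simp [h])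

theorem baseChangeAlgHom_apply (P : Module.End k k[X]) (g : R[X]) :
    baseChangeAlgHom R P g = baseChangeEnd R P g := rfl

theorem baseChange_mem {n : ℕ} : ∀ {P : Module.End k k[X]}, P ∈ diffOpLT k k[X] n →
    baseChangeAlgHom R P ∈ diffOpLT k R[X] n := by
  induction n with
  | zero =>
    intro P hP
    rw [mem_diffOpLT_zero] at hP ⊢
    rw [hP, map_zero]
  | succ n ih =>
    intro P hP g
    induction g using Polynomial.induction_on' with
    | add g h hg hh =>
      have e : comm (baseChangeAlgHom R P) (g + h) =
          comm (baseChangeAlgHom R P) g + comm (baseChangeAlgHom R P) h := by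
        ext x i; simp only [comm_apply, LinearMap.add_apply, add_mul, map_add]; ring_nf
      rw [e]; exact add_mem hg hh
    | monomial j r =>
      have e : comm (baseChangeAlgHom R P) (monomial j r) =
          (C r : R[X]) • baseChangeAlgHom R (comm P (X ^ j)) := by
        ext x : 1
        induction x using Polynomial.induction_on' with
        | add x y hx hy => rw [map_add, map_add, hx, hy]
        | monomial i c =>
          rw [LinearMap.smul_apply, smul_eq_mul, comm_apply, baseChangeAlgHom_apply,
            baseChangeAlgHom_apply, baseChangeAlgHom_apply, monomial_mul_monomial,
            baseChangeEnd_monomial, baseChangeEnd_monomial, baseChangeEnd_monomial, comm_apply,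
            ← pow_add, Polynomial.map_sub, Polynomial.map_mul, Polynomial.map_pow, map_X, map_mul,
            ← C_mul_X_pow_eq_monomial]
          ring
      rw [e]; exact Submodule.smul_mem _ _ (ih (hP _))

variable (k R) in
/-- The morphism `D_{k[t]} → D_{R[t]}` extending operators `R`-linearly. -/
def baseChange : diffOp k k[X] →ₐ[k] diffOp k R[X] :=
  AlgHom.codRestrict ((baseChangeAlgHom R).comp (diffOp k k[X]).val) (diffOp k R[X]) (by
    rintro ⟨P, n, hP⟩
    exact ⟨n, baseChange_mem hP⟩)

end PolynomialRing

/-! ### The algebra of binomial coefficients -/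

section Binomial

/-- The divided power operator `∂_t^{[m]}` on `k[t]` is a differential operator of order `≤ m`. -/
theorem hasseDeriv_mem (k : Type*) [CommRing k] (m : ℕ) :
    hasseDeriv m ∈ diffOpLT k k[X] (m + 1) := by
  induction m using Nat.strong_induction_on with
  | _ m ih =>
    intro a
    have e : comm (hasseDeriv m) a =
        ∑ ij ∈ (Finset.HasAntidiagonal.antidiagonal m).erase (0, m), hasseDeriv ij.1 a • hasseDeriv (R := k) ij.2 := by
      apply LinearMap.ext
      intro x
      rw [comm_apply, hasseDeriv_mul, ← Finset.add_sum_erase _ _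
        (show (0, m) ∈ Finset.HasAntidiagonal.antidiagonal m by simp)]
      simp only [LinearMap.sum_apply, LinearMap.smul_apply, smul_eq_mul, hasseDeriv_zero']
      ring
    rw [e]
    refine Submodule.sum_mem _ ?_
    rintro ⟨i, j⟩ hij
    rw [Finset.mem_erase, Finset.HasAntidiagonal.mem_antidiagonal] at hij
    have hj : j < m := by
      rcases Nat.eq_zero_or_pos i with rfl | hi
      · exact absurd (by simpa using hij.2) (by simpa using hij.1)
      · have := hij.2; simp only at this; omega
    exact Submodule.smul_mem _ _ (diffOpLT_mono hj (ih j hj))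

/-- The higher Euler operator `ν_e = ∂_t^{[p ^ e]} t ^ (p ^ e)` on `k[t]`. -/
def euler (p : ℕ) (k : Type*) [CommRing k] (e : ℕ) : diffOp k k[X] :=
  (⟨hasseDeriv (p ^ e), _, hasseDeriv_mem k _⟩ : diffOp k k[X]) * mulOp k (X ^ p ^ e : k[X])

theorem euler_monomial (p : ℕ) (k : Type*) [CommRing k] (e n : ℕ) (c : k) :
    (euler p k e).1 (monomial n c) = monomial n (((n + p ^ e).choose (p ^ e) : k) * c) := by
  change hasseDeriv (p ^ e) (X ^ p ^ e * monomial n c) = _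
  rw [X_pow_mul_monomial, hasseDeriv_monomial, Nat.add_sub_cancel]

/-- The algebra of binomial coefficients: the `k`-algebra of differential operators on `k[t]` generated
by the higher Euler operators. -/
def binomAlgebra (p : ℕ) (k : Type*) [CommRing k] : Subalgebra k (Module.End k k[X]) :=
  Algebra.adjoin k (Set.range fun e => (euler p k e).1)

/-- The inclusion of the algebra of binomial coefficients into `D_{k[t]}`. -/
def binomToDiffOp (p : ℕ) (k : Type*) [CommRing k] : binomAlgebra p k →ₐ[k] diffOp k k[X] :=
  Subalgebra.inclusion (Algebra.adjoin_le (by rintro _ ⟨e, rfl⟩; exact (euler p k e).2))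

instance (p : ℕ) (k : Type*) [CommRing k] : IsMulCommutative (binomAlgebra p k) := by
  refine Algebra.isMulCommutative_adjoin k ?_
  rintro _ ⟨i, rfl⟩ _ ⟨j, rfl⟩
  apply LinearMap.ext
  intro g
  rw [Module.End.mul_apply, Module.End.mul_apply]
  induction g using Polynomial.induction_on' with
  | add g h hg hh => simp only [map_add, hg, hh]
  | monomial n c => simp only [euler_monomial]; congr 1; ring

/-- The binomial coefficient `(s choose p ^ e) = - ν_e`. -/
def binom (p : ℕ) (k : Type*) [CommRing k] (e : ℕ) : binomAlgebra p k :=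
  ⟨-(euler p k e).1, neg_mem (Algebra.subset_adjoin ⟨e, rfl⟩)⟩

/-- The coefficient `α_e ∈ {0, …, p - 1}` in the `p`-adic expansion `α = ∑ α_e p ^ e`. -/
def digit {p : ℕ} [Fact p.Prime] (α : ℤ_[p]) (e : ℕ) : ℕ := α.appr (e + 1) / p ^ e

/-- The maximal ideal `𝔪` of the algebra of binomial coefficients corresponds to the `p`-adic integer
`α`: for all `e`, the residue class of `(s choose p ^ e)` modulo `𝔪` is the digit `α_e`. -/
def Corresponds {p : ℕ} [Fact p.Prime] {k : Type*} [CommRing k]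
    (𝔪 : Ideal (binomAlgebra p k)) (α : ℤ_[p]) : Prop :=
  𝔪.IsMaximal ∧ ∀ e : ℕ, binom p k e - (digit α e : binomAlgebra p k) ∈ 𝔪

/-- The roots of an ideal `I` of the algebra of binomial coefficients: the `p`-adic integers
corresponding to the maximal ideals that contain `I`. -/
def roots {p : ℕ} [Fact p.Prime] {k : Type*} [CommRing k] (I : Ideal (binomAlgebra p k)) :
    Set ℤ_[p] :=
  {α | ∃ 𝔪 : Ideal (binomAlgebra p k), Corresponds 𝔪 α ∧ I ≤ 𝔪}

end Binomial

/-! ### The `b`-function in the affine case -/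

section Affine

variable (p : ℕ) [Fact p.Prime] (k : Type*) [CommRing k] [CharP k p]
  {R : Type*} [CommRing R] [Algebra k R] (f : R)

/-- The localization `R[t]_{f - t}`. -/
abbrev Loc {R : Type*} [CommRing R] (f : R) : Type _ := Localization.Away (C f - X : R[X])

/-- The image of `R[t]` in `R[t]_{f - t}`. -/
def polyImage : Submodule k (Loc f) :=
  LinearMap.range (IsScalarTower.toAlgHom k R[X] (Loc f)).toLinearMap

/-- `B_f = R[t]_{f - t} / R[t]`. -/
abbrev B : Type _ := Loc f ⧸ polyImage k f

/-- The action of `D_{R[t]}` on `B_f`. -/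
def act : diffOp k R[X] →ₐ[k] Module.End k (B k f) :=
  have h : ∀ P : diffOp k R[X],
      polyImage k f ≤ (polyImage k f).comap (extend (L := Loc f) p (C f - X : R[X]) P).1 := by
    rintro P _ ⟨a, rfl⟩
    exact ⟨P.1 a, (extend_extends (L := Loc f) p (C f - X : R[X]) P a).symm⟩
  AlgHom.ofLinearMap
    { toFun := fun P => (polyImage k f).mapQ (polyImage k f)
        (extend (L := Loc f) p (C f - X : R[X]) P).1 (h P)
      map_add' := by
        intro P Q
        ext x
        simp only [map_add, LinearMap.comp_apply, LinearMap.add_apply, Submodule.mkQ_apply,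
          Submodule.mapQ_apply, Subalgebra.coe_add, Submodule.Quotient.mk_add]
      map_smul' := by
        intro c P
        ext x
        simp only [map_smul, LinearMap.comp_apply, LinearMap.smul_apply, Submodule.mkQ_apply,
          Submodule.mapQ_apply, Subalgebra.coe_smul, Submodule.Quotient.mk_smul,
          RingHom.id_apply] }
    (by
      ext x
      simp)
    (by
      intro P Q
      ext x
      simp)

/-- `δ`, the class of `1 / (f - t)` in `B_f`. -/
def delta : B k f :=
  Submodule.Quotient.mk (IsLocalization.Away.invSelf (S := Loc f) (C f - X : R[X]))

variable (R) in
/-- The subalgebra `D_R[ν_e ; e ∈ ℕ]` of `D_{R[t]}`. -/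
def eulerDiffOp : Subalgebra k (diffOp k R[X]) :=
  Algebra.adjoin k (Set.range (coeffOp (k := k) (R := R)) ∪
    Set.range fun e => baseChange k R (euler p k e))

/-- `M_f = D_R[ν_e ; e ∈ ℕ] δ ⊆ B_f`. -/
def M : Submodule k (B k f) :=
  (Subalgebra.toSubmodule (eulerDiffOp p k R)).map
    ((LinearMap.applyₗ (delta k f)).comp (act p k f).toLinearMap)

/-- `t M_f`. -/
def tM : Submodule k (B k f) :=
  (M p k f).map (act p k f (mulOp k (X : R[X])))

variable (R) in
/-- The algebra of binomial coefficients acts on `B_f` through `D_{k[t]} → D_{R[t]}`. -/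
def binomOp : binomAlgebra p k →ₐ[k] diffOp k R[X] :=
  (baseChange k R).comp (binomToDiffOp p k)

variable (R) in
theorem binomOp_mem (P : binomAlgebra p k) : binomOp p k R P ∈ eulerDiffOp p k R := by
  obtain ⟨P, hP⟩ := P
  refine Algebra.adjoin_induction (p := fun Q hQ => binomOp p k R ⟨Q, hQ⟩ ∈ eulerDiffOp p k R)
    ?_ ?_ ?_ ?_ hP
  · rintro _ ⟨e, rfl⟩
    exact Algebra.subset_adjoin (Or.inr ⟨e, rfl⟩)
  · intro c
    have h : (⟨algebraMap k _ c, Subalgebra.algebraMap_mem _ c⟩ : binomAlgebra p k) =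
        algebraMap k (binomAlgebra p k) c := rfl
    rw [h, AlgHom.commutes]
    exact Subalgebra.algebraMap_mem _ c
  · intro x y hx hy h1 h2
    have h : (⟨x + y, add_mem hx hy⟩ : binomAlgebra p k) = ⟨x, hx⟩ + ⟨y, hy⟩ := rfl
    rw [h, map_add]
    exact Subalgebra.add_mem _ h1 h2
  · intro x y hx hy h1 h2
    have h : (⟨x * y, mul_mem hx hy⟩ : binomAlgebra p k) = ⟨x, hx⟩ * ⟨y, hy⟩ := rfl
    rw [h, map_mul]
    exact Subalgebra.mul_mem _ h1 h2

variable {p k f} in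
theorem act_mem_M {Q : diffOp k R[X]} (hQ : Q ∈ eulerDiffOp p k R) {m : B k f}
    (hm : m ∈ M p k f) : act p k f Q m ∈ M p k f := by
  obtain ⟨P, hP, rfl⟩ := hm
  refine ⟨Q * P, Subalgebra.mul_mem _ hQ hP, ?_⟩
  simp

/-- The `b`-function of `f ∈ R`: the annihilator of `N_f = M_f / t M_f` in the algebra of binomial
coefficients, that is, the ideal of all `P` with `P M_f ⊆ t M_f`. -/
def affineBFunction : Ideal (binomAlgebra p k) where
  carrier := {P | ∀ m ∈ M p k f, act p k f (binomOp p k R P) m ∈ tM p k f}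
  add_mem' := by
    intro P Q hP hQ m hm
    rw [map_add, map_add]
    exact add_mem (hP m hm) (hQ m hm)
  zero_mem' := by
    intro m hm
    rw [map_zero, map_zero]
    exact zero_mem _
  smul_mem' := by
    intro Q P hP m hm
    rw [smul_eq_mul, mul_comm' Q P, map_mul, map_mul]
    exact hP _ (act_mem_M (binomOp_mem p k R Q) hm)

end Affine

/-! ### The `b`-function of a function on a variety -/

section Scheme

variable {k : Type u} [Field k] {X : Scheme.{u}} (π : X ⟶ Spec (.of k))

/-- The structure morphism `k → 𝒪(U)` of an open subset `U` of a scheme `X` over `k`. -/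
def scalars (U : X.Opens) : k →+* Γ(X, U) :=
  ((Scheme.ΓSpecIso (.of k)).inv ≫ π.appLE ⊤ U le_top).hom

/-- The `b`-function of a function `f` on a scheme `X` over `k`. The modules `M_f`, `t M_f` and `N_f` on
`X` are glued from those on the affine open subsets `U` of `X`, so an element of the algebra of
binomial coefficients annihilates `N_f` if and only if it annihilates `N_{f|U}` for all these `U`. -/
def bFunction (p : ℕ) [Fact p.Prime] [CharP k p] (f : Γ(X, ⊤)) : Ideal (binomAlgebra p k) :=
  ⨅ U : X.affineOpens,
    letI : Algebra k Γ(X, U) := (scalars π U).toAlgebra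
    affineBFunction p k (X.presheaf.map (homOfLE (le_top : U.1 ≤ ⊤)).op f)

end Scheme

end CharPBFunction

end

namespace CharPBFunction

/-! ### Periodic `p`-adic integers -/

section Padic

variable {p : ℕ} [Fact p.Prime]

/-! Write D^(e) for the operators on R linear over `p ^ e`-th powers (`powLinear`), and call m a
jump at level e if f^m is not in D^(e) f^(m+1). Since (f - t)^(p^e) = f^(p^e) - t^(p^e), the class δ
equals g / (f - t)^(p^e) with numerator g = ∑ t^i f^(p^e - 1 - i) (`delta_eq_sum`), and operators
linear over `p ^ e`-th powers act on such fractions through the numerator (`act_frac`). The binomial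
algebra contains, for each residue class a modulo p^e, an idempotent that keeps exactly the t^i with
i ≡ -1 - a. On δ it isolates the coefficient f^a, while tM_f provides D^(e) f^(a+1) in the same
degree in t. Hence if a < p^e is not a jump, its idempotent lies in b_f
(`idem_mem_affineBFunction`), whereas the idempotent of a truncation of a root α never lies in the
maximal ideal of α (`idem_notMem`). So every truncation of a root is a jump on some affine open.

Jumps are stable under forgetting the highest digit (`isJump_mod`) or the lowest one
(`IsCoordSystem.isJump_div`), and every jump extends by some lowest digit
(`IsCoordSystem.exists_isJump`). Their number below p^e is bounded independently of e
(`IsCoordSystem.exists_card_le`). Therefore the p-adic integers all of whose truncations are jumps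
form a finite set on which deleting the lowest digit is surjective, hence a permutation. Each of
them is periodic, α = a + p^d α, that is α = -a / (p^d - 1) with 0 ≤ a < p^d. The value 0 is
excluded because 1 lies in D^(e) f for large e.

The statements on jumps are proved where X is étale over affine space with coordinates x: the
monomials x^c with exponents < p are then a basis over the k-span of the p-th powers, and an
operator P has a k-linear Frobenius twist T with T(s^p) = P(s)^p. The cardinality bound is a degree
count: f^m with m < p^e has degree at most p^e b, so its coordinates over the p^e-th powers are
p^e-th powers of bounded degree, up to k-combinations, and jumps give linearly independent
coordinates. The absence of a jump is local (`not_isJumpOn_of_cover`), so quasi-compactness yields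
one étale chart on which all truncations of a root are jumps. -/

theorem appr_eq_of_dvd {x y : ℤ_[p]} {e m : ℕ} (hm : m < p ^ e) (h : x = m + p ^ e * y) :
    x.appr e = m := by
  have h1 := PadicInt.zmod_congr_of_sub_mem_span e x (x.appr e) m (PadicInt.appr_spec e x)
    (Ideal.mem_span_singleton.2 ⟨y, by rw [h]; ring⟩)
  rw [ZMod.natCast_eq_natCast_iff] at h1
  exact Nat.ModEq.eq_of_lt_of_lt h1 (PadicInt.appr_lt x e) hm

theorem eq_appr_add (x : ℤ_[p]) (e : ℕ) : ∃ y : ℤ_[p], x = x.appr e + p ^ e * y := by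
  obtain ⟨y, hy⟩ := Ideal.mem_span_singleton.1 (PadicInt.appr_spec e x)
  exact ⟨y, by rw [← hy]; ring⟩

theorem appr_mod (x : ℤ_[p]) {e e' : ℕ} (h : e ≤ e') : x.appr e' % p ^ e = x.appr e := by
  symm
  have := (Nat.modEq_iff_dvd' (PadicInt.appr_mono x h)).2 (PadicInt.dvd_appr_sub_appr x e e' h)
  rw [← this, Nat.mod_eq_of_lt (PadicInt.appr_lt x e)]

theorem eq_of_appr_eq {x y : ℤ_[p]} (h : ∀ e, x.appr e = y.appr e) : x = y := by
  rw [← PadicInt.ext_of_toZModPow]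
  intro n
  change ((x.appr n : ℕ) : ZMod (p ^ n)) = ((y.appr n : ℕ) : ZMod (p ^ n))
  rw [h]

theorem appr_add_mul {c : ℕ} (hc : c < p) (x : ℤ_[p]) (e : ℕ) :
    ((c : ℤ_[p]) + p * x).appr (e + 1) = p * x.appr e + c := by
  obtain ⟨y, hy⟩ := eq_appr_add x e
  refine appr_eq_of_dvd (y := y) ?_ ?_
  · have := PadicInt.appr_lt x e
    rw [pow_succ']
    calc p * x.appr e + c < p * x.appr e + p := by omega
      _ = p * (x.appr e + 1) := by ring
      _ ≤ p * p ^ e := Nat.mul_le_mul_left p this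
  · conv_lhs => rw [hy]
    push_cast; ring

/-- The `p`-adic integer obtained by removing the lowest digit. -/
noncomputable def shift (x : ℤ_[p]) : ℤ_[p] := (eq_appr_add x 1).choose

theorem eq_add_shift (x : ℤ_[p]) : x = x.appr 1 + p * shift x := by
  have h : x = x.appr 1 + (p : ℤ_[p]) ^ 1 * shift x := (eq_appr_add x 1).choose_spec
  rwa [pow_one] at h

theorem appr_one_lt (x : ℤ_[p]) : x.appr 1 < p := by simpa using PadicInt.appr_lt x 1

theorem shift_add_mul {c : ℕ} (hc : c < p) (x : ℤ_[p]) : shift ((c : ℤ_[p]) + (p : ℤ_[p]) * x) = x := by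
  have h := eq_add_shift ((c : ℤ_[p]) + (p : ℤ_[p]) * x)
  have h1 : ((c : ℤ_[p]) + (p : ℤ_[p]) * x).appr 1 = c := appr_eq_of_dvd (by simpa using hc) (by rw [pow_one])
  rw [h1, add_right_inj] at h
  exact (mul_left_cancel₀ (by exact_mod_cast (Fact.out : p.Prime).ne_zero) h).symm

theorem appr_shift (x : ℤ_[p]) (e : ℕ) : (shift x).appr e = x.appr (e + 1) / p := by
  have h := appr_add_mul (appr_one_lt x) (shift x) e
  rw [← eq_add_shift] at h
  rw [h, Nat.mul_add_div (Fact.out : p.Prime).pos, Nat.div_eq_of_lt (appr_one_lt x), add_zero]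

theorem eq_add_iterate_shift (d : ℕ) (x : ℤ_[p]) :
    ∃ a : ℕ, a < p ^ d ∧ x = a + p ^ d * shift^[d] x := by
  induction d generalizing x with
  | zero => exact ⟨0, by simp⟩
  | succ d ih =>
    obtain ⟨a, ha, h⟩ := ih (shift x)
    refine ⟨p * a + x.appr 1, ?_, ?_⟩
    · have := appr_one_lt x
      rw [pow_succ']
      calc p * a + x.appr 1 < p * a + p := by omega
        _ = p * (a + 1) := by ring
        _ ≤ p * p ^ d := Nat.mul_le_mul_left p ha
    · conv_lhs => rw [eq_add_shift x, h]
      rw [Function.iterate_succ_apply]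
      push_cast; ring

/-- Two distinct p-adic integers differ at some finite level and at all later ones, so the largest
level needed for the pairs in a finite set separates all of them. This transfers a bound on
truncations to the p-adic integers themselves. -/
theorem exists_injOn_appr (T : Finset ℤ_[p]) :
    ∃ e : ℕ, Set.InjOn (fun x : ℤ_[p] => x.appr e) T := by
  have key : ∀ x y : ℤ_[p], ∃ e, x.appr e = y.appr e → x = y := by
    intro x y
    by_contra! h
    exact (h 0).2 (eq_of_appr_eq fun e => (h e).1)
  choose E hE using key
  refine ⟨T.sup fun x => T.sup fun y => E x y, fun x hx y hy hxy => hE x y ?_⟩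
  have hle : E x y ≤ T.sup fun x => T.sup fun y => E x y :=
    (Finset.le_sup (f := fun y => E x y) hy).trans
      (Finset.le_sup (f := fun x => T.sup fun y => E x y) hx)
  rw [← appr_mod x hle, ← appr_mod y hle]
  exact congrArg (· % p ^ E x y) hxy

/-- If the truncations of a `p`-adic integer lie in sets of bounded cardinality which are stable under
forgetting the highest or the lowest digit and in which every element extends by a lowest digit, then
its sequence of digits is periodic. -/
theorem exists_eq_add_pow_mul (S : ℕ → Set ℕ) (N : ℕ)
    (hcard : ∀ (e : ℕ) (T : Finset ℕ), (∀ m ∈ T, m < p ^ e ∧ m ∈ S e) → T.card ≤ N)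
    (hmod : ∀ e m, m ∈ S (e + 1) → m % p ^ e ∈ S e)
    (hdiv : ∀ e m, m ∈ S (e + 1) → m / p ∈ S e)
    (hext : ∀ e m, m ∈ S e → ∃ c < p, p * m + c ∈ S (e + 1))
    (x : ℤ_[p]) (hx : ∀ e, x.appr e ∈ S e) :
    ∃ d > 0, ∃ a < p ^ d, x = a + p ^ d * x := by
  -- The set to be shown finite and permuted by `shift`.
  let Z : Set ℤ_[p] := {y | ∀ e, y.appr e ∈ S e}
  have hdown : ∀ (y : ℤ_[p]) (e e' : ℕ), e ≤ e' → y.appr e' ∈ S e' → y.appr e ∈ S e := by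
    intro y e e' h
    induction e', h using Nat.le_induction with
    | base => exact id
    | succ n h ih =>
      intro hy
      apply ih
      rw [← appr_mod y (Nat.le_succ n)]
      exact hmod _ _ hy
  have hfin : Z.Finite := by
    by_contra hinf
    obtain ⟨T, hTZ, hT⟩ := Set.Infinite.exists_subset_card_eq hinf (N + 1)
    obtain ⟨e, he⟩ := exists_injOn_appr T
    have h1 := hcard e (T.image fun y => y.appr e) (by
      intro m hm
      obtain ⟨y, hy, rfl⟩ := Finset.mem_image.1 hm
      exact ⟨PadicInt.appr_lt y e, hTZ hy e⟩)
    rw [Finset.card_image_of_injOn he, hT] at h1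
    omega
  have hsh : Set.MapsTo shift Z Z := by
    intro y hy e
    rw [appr_shift]
    exact hdiv _ _ (hy (e + 1))
  have hsurj : Set.SurjOn shift Z Z := by
    intro y hy
    suffices ∃ c < p, (c : ℤ_[p]) + p * y ∈ Z by
      obtain ⟨c, hc, h⟩ := this
      exact ⟨_, h, shift_add_mul hc y⟩
    -- Compactness: if each lowest digit c failed at some level `E c`, then `hext` at the largest of
    -- these levels would produce a digit that has not failed, since membership descends to lower
    -- levels.
    by_contra! hno
    have hno' : ∀ c : ℕ, ∃ e, c < p → ((c : ℤ_[p]) + p * y).appr e ∉ S e := by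
      intro c
      by_contra! h
      exact hno c (h 0).1 fun e => (h e).2
    choose E hE using hno'
    obtain ⟨c, hc, h⟩ := hext _ _ (hy ((Finset.range p).sup E))
    rw [← appr_add_mul hc] at h
    refine hE c hc (hdown _ _ _ ?_ h)
    exact (Finset.le_sup (f := E) (Finset.mem_range.2 hc)).trans (Nat.le_succ _)
  have : Finite Z := hfin
  -- A surjective self-map of a finite set is injective, so every point is periodic.
  have hinj : Function.Injective (hsh.restrict shift Z Z) :=
    Finite.injective_iff_surjective.2 ((Set.MapsTo.restrict_surjective_iff hsh).2 hsurj)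
  obtain ⟨d, hd, hper⟩ := hinj.mem_periodicPts ⟨x, hx⟩
  have hit : shift^[d] x = x := by
    have := congrArg Subtype.val hper
    rwa [hsh.iterate_restrict] at this
  obtain ⟨a, ha, h⟩ := eq_add_iterate_shift d x
  exact ⟨d, hd, a, ha, by rwa [hit] at h⟩

/-- Solving the equation gives x = -a / (p^d - 1). The bound a < p^d gives x ≥ -1, and x ≠ 0 forces
a > 0. -/
theorem exists_rat_of_eq_add_pow_mul {x : ℤ_[p]} (hx : x ≠ 0) {d a : ℕ} (hd : 0 < d)
    (ha : a < p ^ d) (h : x = a + p ^ d * x) :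
    ∃ q : ℚ, (x : ℚ_[p]) = (q : ℚ_[p]) ∧ -1 ≤ q ∧ q < 0 := by
  have hp : 1 < p ^ d := Nat.one_lt_pow hd.ne' (Fact.out : p.Prime).one_lt
  have hpos : (0 : ℚ) < (p ^ d : ℕ) - 1 := by
    rw [sub_pos]; exact_mod_cast hp
  have h' : (x : ℚ_[p]) = a + p ^ d * x := by
    conv_lhs => rw [h]
    push_cast; rfl
  have ha0 : 0 < a := by
    rcases Nat.eq_zero_or_pos a with rfl | h0
    · exfalso
      apply hx
      have h1 : ((p ^ d : ℕ) - 1 : ℤ_[p]) * x = 0 := by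
        push_cast
        linear_combination (-1 : ℤ_[p]) * h
      exact (mul_eq_zero.1 h1).resolve_left (sub_ne_zero.2 (by exact_mod_cast hp.ne'))
    · exact h0
  refine ⟨-a / ((p ^ d : ℕ) - 1), ?_, ?_, ?_⟩
  · push_cast
    rw [eq_div_iff (by rw [sub_ne_zero]; exact_mod_cast hp.ne')]
    linear_combination (-1 : ℚ_[p]) * h'
  · rw [le_div_iff₀ hpos]
    have : (a : ℚ) + 1 ≤ (p ^ d : ℕ) := by exact_mod_cast ha
    linarith
  · exact div_neg_of_neg_of_pos (by simpa using ha0) hpos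

end Padic

end CharPBFunction

noncomputable section
namespace CharPBFunction

/-! ### Operators linear over `q`-th powers -/

section PowLinear

variable (k R : Type*) [CommRing k] [CommRing R] [Algebra k R]

/-- The algebra of the `k`-linear operators on `R` which are linear over the `q`-th powers. -/
def powLinear (q : ℕ) : Subalgebra k (Module.End k R) where
  carrier := {P | ∀ a x : R, P (a ^ q * x) = a ^ q * P x}
  mul_mem' := by
    intro P Q hP hQ a x
    rw [Module.End.mul_apply, hQ, hP, Module.End.mul_apply]
  add_mem' := by
    intro P Q hP hQ a x
    rw [LinearMap.add_apply, hP, hQ, LinearMap.add_apply, mul_add]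
  algebraMap_mem' := by
    intro c a x
    rw [Module.algebraMap_end_apply, Module.algebraMap_end_apply, mul_smul_comm]

variable {k R}

theorem powLinear_mono {q q' : ℕ} (h : q ∣ q') : powLinear k R q ≤ powLinear k R q' := by
  obtain ⟨c, rfl⟩ := h
  intro P hP a x
  rw [mul_comm q, pow_mul, hP]

theorem lmul_mem_powLinear (q : ℕ) (a : R) : Algebra.lmul k R a ∈ powLinear k R q := by
  intro b x
  exact mul_left_comm a (b ^ q) x

theorem mem_powLinear_of_mem_diffOpLT (p : ℕ) [Fact p.Prime] [CharP k p] {n e : ℕ}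
    (hn : n ≤ p ^ e) {P : Module.End k R} (hP : P ∈ diffOpLT k R n) : P ∈ powLinear k R (p ^ e) :=
  fun a x => apply_pow_mul p hn hP a x

theorem comm_mem_diffOpLT {n : ℕ} {P : Module.End k R} (hP : P ∈ diffOpLT k R n) (a : R) :
    comm P a ∈ diffOpLT k R n := by
  rcases n with _ | n
  · have : comm P a = 0 := by rw [mem_diffOpLT_zero.1 hP]; ext x; simp [comm_apply]
    rw [this]; exact zero_mem _
  · exact diffOpLT_le_succ n (hP a)

theorem mul_lmul_mem_diffOpLT {n : ℕ} {P : Module.End k R} (hP : P ∈ diffOpLT k R n) (a : R) :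
    P * Algebra.lmul k R a ∈ diffOpLT k R n := by
  have : P * Algebra.lmul k R a = a • P + comm P a := by
    ext x; simp [comm_apply]
  rw [this]
  exact add_mem (Submodule.smul_mem _ _ hP) (comm_mem_diffOpLT hP a)

/-- The identity [P, ab] = [P, a] b + a [P, b] reduces the order condition to generators. -/
theorem comm_mem_of_adjoin {n : ℕ} {P : Module.End k R} {S : Set R} (hS : Algebra.adjoin k S = ⊤)
    (h : ∀ y ∈ S, comm P y ∈ diffOpLT k R n) : P ∈ diffOpLT k R (n + 1) := by
  intro a
  have ha : a ∈ Algebra.adjoin k S := hS ▸ Algebra.mem_top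
  induction ha using Algebra.adjoin_induction with
  | mem y hy => exact h y hy
  | algebraMap c =>
    have : comm P (algebraMap k R c) = 0 := by
      ext x; simp [comm_apply, ← Algebra.smul_def]
    rw [this]; exact zero_mem _
  | add a b _ _ ha hb =>
    have : comm P (a + b) = comm P a + comm P b := by
      ext x; simp only [comm_apply, LinearMap.add_apply, add_mul, map_add]; ring
    rw [this]; exact add_mem ha hb
  | mul a b _ _ ha hb =>
    have : comm P (a * b) = comm P a * Algebra.lmul k R b + a • comm P b := by
      ext x
      simp only [comm_apply, LinearMap.add_apply, LinearMap.smul_apply, smul_eq_mul,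
        Module.End.mul_apply, Algebra.coe_lmul_eq_mul, LinearMap.mul_apply', mul_assoc]
      ring
    rw [this]; exact add_mem (mul_lmul_mem_diffOpLT ha b) (Submodule.smul_mem _ _ hb)

variable (k) in
/-- The operator `[·, a]` on `k`-linear endomorphisms. -/
def commHom (a : R) : Module.End k (Module.End k R) :=
  LinearMap.mulRight k (Algebra.lmul k R a) - LinearMap.mulLeft k (Algebra.lmul k R a)

theorem commHom_apply (a : R) (P : Module.End k R) : commHom k a P = comm P a := rfl

theorem commHom_commute (a b : R) : Commute (commHom k a) (commHom k b) := by
  apply LinearMap.ext; intro P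
  ext x
  simp only [Module.End.mul_apply, commHom_apply, comm_apply, mul_left_comm a b x]
  ring

/-- The bracket is a difference of two commuting operators, right and left multiplication, so in
characteristic p its `p ^ e`-th power is the difference of the `p ^ e`-th powers. -/
theorem commHom_pow (p : ℕ) [Fact p.Prime] [CharP k p] (e : ℕ) (a : R) :
    commHom k a ^ p ^ e = commHom k (a ^ p ^ e) := by
  rcases subsingleton_or_nontrivial R with hR | hR
  · exact Subsingleton.elim _ _
  have hp : (p : Module.End k (Module.End k R)) = 0 := by
    rw [← map_natCast (algebraMap k (Module.End k (Module.End k R))), CharP.cast_eq_zero, map_zero]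
  have : CharP (Module.End k (Module.End k R)) p :=
    (CharP.charP_iff_prime_eq_zero (Fact.out : p.Prime)).2 hp
  have key := sub_pow_char_pow_of_commute (R := Module.End k (Module.End k R)) (p := p) (n := e)
    (LinearMap.commute_mulLeft_right (R := k) (Algebra.lmul k R a) (Algebra.lmul k R a)).symm
  refine key.trans ?_
  rw [LinearMap.pow_mulRight, LinearMap.pow_mulLeft, ← map_pow, commHom]

/-- Induction on the sum of the exponents: one bracket with y lowers the exponent of y by one, and
leaves the other conditions intact because brackets commute. -/
theorem mem_diffOpLT_of_commHom_pow (s : Finset R) (hs : Algebra.adjoin k (s : Set R) = ⊤) (n : ℕ) :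
    ∀ (c : R → ℕ) (P : Module.End k R), ∑ y ∈ s, c y ≤ n →
      (∀ y ∈ s, (commHom k y ^ c y) P = 0) → P ∈ diffOpLT k R (n + 1) := by
  classical
  have hzero : ∀ (n : ℕ) (c : R → ℕ) (P : Module.End k R) (y : R), (commHom k y ^ c y) P = 0 →
      c y = 0 → comm P y ∈ diffOpLT k R n := by
    intro n c P y h hy
    rw [hy, pow_zero, Module.End.one_apply] at h
    rw [h, ← commHom_apply, map_zero]
    exact zero_mem _
  induction n with
  | zero =>
    intro c P hc h
    refine comm_mem_of_adjoin hs fun y hy => hzero 0 c P y (h y hy) ?_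
    have := Finset.single_le_sum (fun i _ => Nat.zero_le (c i)) hy
    omega
  | succ n ih =>
    intro c P hc h
    refine comm_mem_of_adjoin hs fun y hy => ?_
    rcases Nat.eq_zero_or_pos (c y) with hy0 | hy0
    · exact hzero _ c P y (h y hy) hy0
    refine ih (Function.update c y (c y - 1)) _ ?_ ?_
    · rw [← Finset.add_sum_erase _ _ hy] at hc ⊢
      rw [Function.update_self, Finset.sum_congr rfl fun z hz =>
        Function.update_of_ne (Finset.ne_of_mem_erase hz) _ _]
      omega
    · intro z hz
      rw [← commHom_apply]
      rcases eq_or_ne z y with rfl | hne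
      · rw [Function.update_self, ← Module.End.mul_apply, ← pow_succ, Nat.sub_add_cancel hy0, h z hz]
      · rw [Function.update_of_ne hne, ← Module.End.mul_apply,
          ((commHom_commute z y).pow_left _).eq, Module.End.mul_apply, h z hz, map_zero]

/-- On an algebra of finite type, operators linear over `p ^ e`-th powers are differential
operators. -/
theorem powLinear_le_diffOp (p : ℕ) [Fact p.Prime] [CharP k p] [Algebra.FiniteType k R] (e : ℕ) :
    powLinear k R (p ^ e) ≤ diffOp k R := by
  intro P hP
  obtain ⟨s, hs⟩ := Algebra.FiniteType.out (R := k) (A := R)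
  refine ⟨_, mem_diffOpLT_of_commHom_pow s hs _ (fun _ => p ^ e) P le_rfl fun y _ => ?_⟩
  -- The `p ^ e`-fold bracket with y is the single bracket with the `p ^ e`-th power of y, which
  -- vanishes on P.
  rw [commHom_pow, commHom_apply]
  ext x
  rw [comm_apply, hP, sub_self, LinearMap.zero_apply]

theorem coeffEnd_monomial (P : Module.End k R) (i : ℕ) (r : R) :
    coeffEnd P (monomial i r) = monomial i (P r) := by
  ext j
  rw [coeff_coeffEnd, coeff_monomial, coeff_monomial]
  split_ifs <;> simp

theorem charP_of_algebra (k R : Type*) [CommRing k] [CommRing R] [Algebra k R] (p : ℕ)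
    [Fact p.Prime] [CharP k p] [Nontrivial R] : CharP R p := by
  rw [CharP.charP_iff_prime_eq_zero (Fact.out : p.Prime), ← map_natCast (algebraMap k R),
    CharP.cast_eq_zero, map_zero]

theorem coeffEnd_mem_powLinear (p : ℕ) [Fact p.Prime] [CharP k p] {e : ℕ} {P : Module.End k R}
    (hP : P ∈ powLinear k R (p ^ e)) : coeffEnd P ∈ powLinear k R[X] (p ^ e) := by
  rcases subsingleton_or_nontrivial R with hR | hR
  · intro a x; exact Subsingleton.elim _ _
  have := charP_of_algebra k R p
  intro a x
  induction a using Polynomial.induction_on' with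
  | add a b ha hb => rw [add_pow_char_pow, add_mul, add_mul, map_add, ha, hb]
  | monomial n r =>
    induction x using Polynomial.induction_on' with
    | add x y hx hy => rw [mul_add, map_add, map_add, mul_add, hx, hy]
    | monomial i c =>
      rw [monomial_pow, monomial_mul_monomial, coeffEnd_monomial, coeffEnd_monomial, hP,
        monomial_mul_monomial]

end PowLinear
end CharPBFunction

end

noncomputable section
namespace CharPBFunction

/-! ### Idempotents in the algebra of binomial coefficients -/

section Idempotents

/-- The sum of the two remainders plus 1 lies strictly between 0 and 2n, so if divisible by n it
equals n. -/
theorem succ_add_eq_mul {n i a : ℕ} (hn : 0 < n) (h : n ∣ i + 1 + a) :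
    i + 1 + a = n * (i / n + 1 + a / n) := by
  have hi := Nat.div_add_mod i n
  have ha := Nat.div_add_mod a n
  have hi' := Nat.mod_lt i hn
  have ha' := Nat.mod_lt a hn
  have h1 : n ∣ i % n + 1 + a % n := by
    have h2 : i + 1 + a = n * (i / n + a / n) + (i % n + 1 + a % n) := by
      rw [mul_add]; omega
    rw [h2] at h
    exact (Nat.dvd_add_right (dvd_mul_right n _)).1 h
  obtain ⟨c, hc⟩ := h1
  have hc1 : c = 1 := by
    have h0 : 0 < c := by
      rcases Nat.eq_zero_or_pos c with rfl | h0
      · omega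
      · exact h0
    by_contra hne
    have : n * 2 ≤ n * c := Nat.mul_le_mul_left n (by omega)
    omega
  rw [hc1, mul_one] at hc
  rw [mul_add, mul_add, mul_one]
  omega

/-- The congruence i ≡ -1 - a modulo p^e, tested one digit at a time; this matches the factors of
`idem`. -/
theorem forall_dvd_iff_pow_dvd {p : ℕ} (hp : 0 < p) (e i a : ℕ) :
    (∀ j < e, p ∣ i / p ^ j + 1 + a / p ^ j) ↔ p ^ e ∣ i + 1 + a := by
  induction e with
  | zero => simp
  | succ e ih =>
    have hpos : 0 < p ^ e := pow_pos hp e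
    constructor
    · intro h
      have h1 := ih.1 fun j hj => h j (hj.trans (Nat.lt_succ_self e))
      rw [succ_add_eq_mul hpos h1, pow_succ]
      exact Nat.mul_dvd_mul_left _ (h e (Nat.lt_succ_self e))
    · intro h j hj
      have h1 := (pow_dvd_pow p (Nat.le_succ e)).trans h
      rcases Nat.lt_succ_iff_lt_or_eq.1 hj with hj | rfl
      · exact ih.2 h1 j hj
      · rw [succ_add_eq_mul hpos h1, pow_succ] at h
        exact Nat.dvd_of_mul_dvd_mul_left hpos h

variable (p : ℕ) [Fact p.Prime] (k : Type*) [CommRing k] [CharP k p]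

/-- Fermat's little theorem, which turns a condition on a digit into a value 0 or 1. -/
theorem neg_natCast_pow (n : ℕ) :
    (-(n : k)) ^ (p - 1) = if p ∣ n then 0 else 1 := by
  have hp := (Fact.out : p.Prime).two_le
  split_ifs with h
  · rw [(CharP.cast_eq_zero_iff k p n).2 h, neg_zero, zero_pow (by omega)]
  · have h1 : (-(n : ZMod p)) ^ (p - 1) = 1 :=
      ZMod.pow_card_sub_one_eq_one (neg_ne_zero.2 fun h0 => h ((ZMod.natCast_eq_zero_iff n p).1 h0))
    have h2 := congrArg (ZMod.castHom (dvd_refl p) k) h1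
    rwa [map_pow, map_neg, map_natCast, map_one] at h2

/-- Lucas' congruence: the digits of p^j below position j are zero and contribute factors 1. -/
theorem natCast_choose_pow (i j : ℕ) :
    (((i + p ^ j).choose (p ^ j) : ℕ) : k) = (i / p ^ j + 1 : ℕ) := by
  have hpos : 0 < p ^ j := pow_pos (Fact.out : p.Prime).pos j
  have h := Choose.choose_modEq_choose_mul_prod_range_choose (n := i + p ^ j) (k := p ^ j) (p := p) j
  rw [Nat.add_div_right _ hpos, Nat.div_self hpos, Nat.choose_one_right, Finset.prod_eq_one, Nat.cast_one, mul_one]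
    at h
  · have h1 := (ZMod.intCast_eq_intCast_iff _ _ p).2 h
    have h2 := congrArg (ZMod.castHom (dvd_refl p) k) h1
    simpa only [Int.cast_natCast, map_natCast] using h2
  · intro l hl
    have hl := Finset.mem_range.1 hl
    have : p ^ j / p ^ l % p = 0 := by
      rw [Nat.pow_div hl.le (Fact.out : p.Prime).pos]
      exact Nat.mod_eq_zero_of_dvd (dvd_pow_self p (by omega))
    rw [this, Nat.choose_zero_right]

/-- The idempotent of the algebra of binomial coefficients that is `1` at the `p`-adic integers
congruent to `a` modulo `p ^ e` and `0` at the others. -/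
def idem (e a : ℕ) : binomAlgebra p k :=
  (List.ofFn fun j : Fin e => 1 - (binom p k j - ((a / p ^ (j : ℕ) : ℕ) : binomAlgebra p k)) ^ (p - 1)).prod

variable {p k} in
theorem mul_apply_of_eigen {P Q : Module.End k k[X]} {c d : k} {x : k[X]} (hP : P x = c • x)
    (hQ : Q x = d • x) : (P * Q) x = (c * d) • x := by
  rw [Module.End.mul_apply, hQ, map_smul, hP, smul_smul, mul_comm]

variable {p k} in
theorem pow_apply_of_eigen {P : Module.End k k[X]} {c : k} {x : k[X]} (hP : P x = c • x) (n : ℕ) :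
    (P ^ n) x = (c ^ n) • x := by
  induction n with
  | zero => simp
  | succ n ih => rw [pow_succ, pow_succ]; exact mul_apply_of_eigen ih hP

variable {p k} in
theorem list_prod_apply_of_eigen {x : k[X]} (l : List (Module.End k k[X] × k))
    (h : ∀ y ∈ l, y.1 x = y.2 • x) : (l.map Prod.fst).prod x = (l.map Prod.snd).prod • x := by
  induction l with
  | nil => simp
  | cons a l ih =>
    rw [List.map_cons, List.map_cons, List.prod_cons, List.prod_cons]
    exact mul_apply_of_eigen (h a List.mem_cons_self) (ih fun y hy => h y (List.mem_cons_of_mem _ hy))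

/-- The monomial t^i is an eigenvector of `binom p k j` with eigenvalue -(i / p^j + 1), so it sits
at s = -1 - i; the factor tests whether the j-th digit there agrees with that of a. -/
theorem binom_factor_apply (a i j : ℕ) :
    (1 - (binom p k j - ((a / p ^ j : ℕ) : binomAlgebra p k)) ^ (p - 1)).1 (X ^ i : k[X]) =
      (if p ∣ i / p ^ j + 1 + a / p ^ j then 1 else 0 : k) • (X ^ i : k[X]) := by
  have h1 : (binom p k j - ((a / p ^ j : ℕ) : binomAlgebra p k)).1 (X ^ i : k[X]) =
      (-((i / p ^ j + 1 + a / p ^ j : ℕ) : k)) • (X ^ i : k[X]) := by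
    change -((euler p k j).1 (X ^ i)) - ((a / p ^ j : ℕ) : binomAlgebra p k).1 (X ^ i : k[X]) = _
    have : ((a / p ^ j : ℕ) : binomAlgebra p k).1 (X ^ i : k[X]) = ((a / p ^ j : ℕ) : k) • X ^ i := by
      rw [SubringClass.coe_natCast, ← map_natCast (algebraMap k (Module.End k k[X]))]
      rfl
    rw [this, ← monomial_one_right_eq_X_pow, euler_monomial, natCast_choose_pow, smul_monomial,
      smul_monomial, ← map_neg, ← map_sub]
    congr 1
    push_cast
    simp only [smul_eq_mul]
    ring
  have h2 := pow_apply_of_eigen h1 (p - 1)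
  change X ^ i - ((binom p k j - ((a / p ^ j : ℕ) : binomAlgebra p k)).1 ^ (p - 1)) (X ^ i) = _
  rw [h2, neg_natCast_pow p k]
  split_ifs <;> simp

theorem idem_apply (e a i : ℕ) :
    (idem p k e a).1 (X ^ i : k[X]) =
      (if p ^ e ∣ i + 1 + a then 1 else 0 : k) • (X ^ i : k[X]) := by
  have h := list_prod_apply_of_eigen (k := k) (x := X ^ i) (List.ofFn fun j : Fin e =>
    ((1 - (binom p k j - ((a / p ^ (j : ℕ) : ℕ) : binomAlgebra p k)) ^ (p - 1)).1,
      if p ∣ i / p ^ (j : ℕ) + 1 + a / p ^ (j : ℕ) then 1 else 0)) (by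
    intro y hy
    obtain ⟨j, rfl⟩ := List.mem_ofFn.1 hy
    exact binom_factor_apply p k a i j)
  rw [List.map_ofFn, List.map_ofFn] at h
  have h1 : (idem p k e a).1 = (List.ofFn (Prod.fst ∘ fun j : Fin e =>
    ((1 - (binom p k j - ((a / p ^ (j : ℕ) : ℕ) : binomAlgebra p k)) ^ (p - 1)).1,
      if p ∣ i / p ^ (j : ℕ) + 1 + a / p ^ (j : ℕ) then (1 : k) else 0))).prod := by
    rw [idem]
    change (binomAlgebra p k).val _ = _
    rw [map_list_prod, List.map_ofFn]
    rfl
  rw [h1, h, List.prod_ofFn]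
  congr 1
  simp only [Function.comp_apply]
  rw [Finset.prod_ite_zero]
  simp only [← forall_dvd_iff_pow_dvd (Fact.out : p.Prime).pos, Finset.mem_univ, true_implies,
    Finset.prod_const_one, Fin.forall_iff]

theorem one_sub_list_prod_mem {A : Type*} [Ring A] (I : Ideal A) (l : List A)
    (h : ∀ u ∈ l, 1 - u ∈ I) : 1 - l.prod ∈ I := by
  induction l with
  | nil => simp
  | cons u l ih =>
    have : 1 - (u :: l).prod = (1 - u) + u * (1 - l.prod) := by
      rw [List.prod_cons]; noncomm_ring
    rw [this]
    exact add_mem (h u List.mem_cons_self)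
      (I.mul_mem_left _ (ih fun v hv => h v (List.mem_cons_of_mem _ hv)))

theorem list_prod_one_sub_pow_notMem {A ι : Type*} [Ring A] {I : Ideal A} (hI : I ≠ ⊤) (l : List ι)
    (x : ι → A) (n : ℕ) (hn : n ≠ 0) (h : ∀ i ∈ l, x i ∈ I) :
    (l.map fun i => 1 - x i ^ n).prod ∉ I := by
  intro hmem
  apply hI
  rw [Ideal.eq_top_iff_one]
  have h1 := one_sub_list_prod_mem I (l.map fun i => 1 - x i ^ n) (by
    intro u hu
    obtain ⟨i, hi, rfl⟩ := List.mem_map.1 hu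
    obtain ⟨m, rfl⟩ := Nat.exists_eq_succ_of_ne_zero hn
    rw [sub_sub_cancel, pow_succ]
    exact I.mul_mem_left _ (h i hi))
  simpa using add_mem h1 hmem

/-- The digits above position j contribute a multiple of p, which is 0 in k. -/
theorem natCast_digit (α : ℤ_[p]) {j e : ℕ} (h : j < e) :
    ((α.appr e / p ^ j : ℕ) : binomAlgebra p k) = (digit α j : ℕ) := by
  have hp : (p : binomAlgebra p k) = 0 := by
    rw [← map_natCast (algebraMap k (binomAlgebra p k)), CharP.cast_eq_zero, map_zero]
  have h1 : digit α j = α.appr e / p ^ j % p := by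
    rw [digit, ← appr_mod α (Nat.succ_le_of_lt h), Nat.succ_eq_add_one, pow_succ,
      Nat.mod_mul_right_div_self]
  rw [h1]
  conv_lhs => rw [← Nat.div_add_mod (α.appr e / p ^ j) p]
  rw [Nat.cast_add, Nat.cast_mul, hp, zero_mul, zero_add]

/-- Modulo the maximal ideal of α each factor of the idempotent is 1 - 0, so the product is 1. -/
theorem idem_notMem {𝔪 : Ideal (binomAlgebra p k)} {α : ℤ_[p]} (h : Corresponds 𝔪 α) (e : ℕ) :
    idem p k e (α.appr e) ∉ 𝔪 := by
  have h1 := list_prod_one_sub_pow_notMem (A := binomAlgebra p k) h.1.ne_top (List.finRange e)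
    (fun j => binom p k j - ((α.appr e / p ^ (j : ℕ) : ℕ) : binomAlgebra p k)) (p - 1)
    (Nat.sub_ne_zero_of_lt (Fact.out : p.Prime).one_lt) (fun j _ => by
      rw [natCast_digit p k α j.2]
      exact h.2 j)
  rw [idem, List.ofFn_eq_map]
  exact h1

end Idempotents
end CharPBFunction

end

noncomputable section
namespace CharPBFunction

/-! ### Jumps, and the `b`-function in the affine case -/

section Jumps

variable (p : ℕ) [Fact p.Prime] (k : Type*) [CommRing k] [CharP k p]
  {R : Type*} [CommRing R] [Algebra k R] (f : R)

/-- `f ^ m` is not in the module generated by `f ^ (m + 1)` over the operators linear over the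
`p ^ e`-th powers. -/
def IsJump (e m : ℕ) : Prop :=
  ¬ ∃ P ∈ powLinear k R (p ^ e), P (f ^ (m + 1)) = f ^ m

/-- The class of `g / (f - t) ^ q` in `B_f`. -/
def frac (q : ℕ) : R[X] →ₗ[k] B k f :=
  (polyImage k f).mkQ ∘ₗ LinearMap.mulRight k
    (IsLocalization.Away.invSelf (S := Loc f) (C f - X : R[X]) ^ q) ∘ₗ
      (IsScalarTower.toAlgHom k R[X] (Loc f)).toLinearMap

theorem frac_apply (q : ℕ) (g : R[X]) : frac k f q g = Submodule.Quotient.mk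
    (algebraMap R[X] (Loc f) g *
      IsLocalization.Away.invSelf (S := Loc f) (C f - X : R[X]) ^ q) := rfl

theorem algebraMap_pow_mul_invSelf_pow (q : ℕ) :
    algebraMap R[X] (Loc f) (C f - X) ^ q *
      IsLocalization.Away.invSelf (S := Loc f) (C f - X : R[X]) ^ q = 1 := by
  rw [← mul_pow, IsLocalization.Away.mul_invSelf, one_pow]

theorem frac_pow_eq_zero (q : ℕ) : frac k f q ((C f - X) ^ q) = 0 := by
  rw [frac_apply, map_pow, algebraMap_pow_mul_invSelf_pow, Submodule.Quotient.mk_eq_zero]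
  exact ⟨1, map_one (algebraMap R[X] (Loc f))⟩

theorem extend_pow_mul {e : ℕ} {Q : diffOp k R[X]} (hQ : Q.1 ∈ powLinear k R[X] (p ^ e))
    (x : Loc f) :
    (extend (L := Loc f) p (C f - X : R[X]) Q).1 (algebraMap R[X] (Loc f) (C f - X) ^ p ^ e * x) =
      algebraMap R[X] (Loc f) (C f - X) ^ p ^ e *
        (extend (L := Loc f) p (C f - X : R[X]) Q).1 x := by
  have hpos : 0 < p ^ e := pow_pos (Fact.out : p.Prime).pos e
  obtain ⟨E, hE, hEq⟩ := exists_extends_of_linear (L := Loc f) (C f - X : R[X]) (p ^ e) hpos Q.1 hQ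
  obtain ⟨n, hn⟩ := Q.2
  have hmem := mem_diffOpLT_of_extends (L := Loc f) (C f - X : R[X]) (p ^ e) hpos n Q.1 E hn hE hEq
  have : extend (L := Loc f) p (C f - X : R[X]) Q = ⟨E, n, hmem⟩ :=
    (existsUnique_extends (L := Loc f) p (C f - X : R[X]) Q).unique
      (extend_extends (L := Loc f) p (C f - X : R[X]) Q) hE
  rw [this]
  exact hEq x

/-- Operators linear over `q`-th powers act on `g / (f - t) ^ q` through the numerator. -/
theorem act_frac {e : ℕ} {Q : diffOp k R[X]} (hQ : Q.1 ∈ powLinear k R[X] (p ^ e)) (g : R[X]) :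
    act p k f Q (frac k f (p ^ e) g) = frac k f (p ^ e) (Q.1 g) := by
  rw [frac_apply, frac_apply]
  change Submodule.Quotient.mk ((extend (L := Loc f) p (C f - X : R[X]) Q).1 _) = _
  congr 1
  apply (isUnit_algebraMap_pow (L := Loc f) (C f - X : R[X]) (p ^ e)).mul_left_cancel
  rw [← extend_pow_mul p k f hQ, mul_left_comm, algebraMap_pow_mul_invSelf_pow, mul_one,
    mul_left_comm, algebraMap_pow_mul_invSelf_pow, mul_one,
    extend_extends (L := Loc f) p (C f - X : R[X]) Q]

theorem act_X_frac (e : ℕ) (g : R[X]) :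
    act p k f (mulOp k X) (frac k f (p ^ e) g) = frac k f (p ^ e) (X * g) :=
  act_frac p k f (lmul_mem_powLinear _ _) g

/-- The sum is the quotient of f^(p^e) - t^(p^e) = (f - t)^(p^e) by f - t, a geometric sum. -/
theorem delta_eq_sum (e : ℕ) :
    delta k f = ∑ i ∈ Finset.range (p ^ e), frac k f (p ^ e) (monomial i (f ^ (p ^ e - 1 - i))) := by
  rcases subsingleton_or_nontrivial R with hR | hR
  · have : Subsingleton (Loc f) := (algebraMap R[X] (Loc f)).codomain_trivial
    exact Subsingleton.elim _ _
  have := charP_of_algebra k R p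
  rw [← map_sum, frac_apply, delta]
  congr 1
  apply (isUnit_algebraMap_pow (L := Loc f) (C f - X : R[X]) 1).mul_left_cancel
  rw [pow_one, IsLocalization.Away.mul_invSelf, ← mul_assoc, ← map_mul]
  have h : (C f - X) * ∑ i ∈ Finset.range (p ^ e), monomial i (f ^ (p ^ e - 1 - i)) =
      (C f - X : R[X]) ^ p ^ e := by
    rw [sub_pow_char_pow, ← neg_sub X, ← neg_sub (X ^ p ^ e), ← geom_sum₂_mul, neg_mul, mul_comm]
    congr 2
    refine Finset.sum_congr rfl fun i _ => ?_
    rw [← C_mul_X_pow_eq_monomial, C_pow, mul_comm]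
  rw [h, map_pow, algebraMap_pow_mul_invSelf_pow]

/-- The numerator (f - t)^(p^e) = f^(p^e) - t^(p^e) gives the zero class, so f^(p^e) and t^(p^e)
represent the same one. Multiplication by t thus wraps from the top degree p^e - 1 to degree 0. -/
theorem X_mul_frac (e : ℕ) :
    frac k f (p ^ e) (monomial 0 (f ^ p ^ e)) =
      frac k f (p ^ e) (X * monomial (p ^ e - 1) 1) := by
  rcases subsingleton_or_nontrivial R with hR | hR
  · congr 1; exact Subsingleton.elim _ _
  have := charP_of_algebra k R p
  have hpos : 0 < p ^ e := pow_pos (Fact.out : p.Prime).pos e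
  have h := frac_pow_eq_zero k f (p ^ e)
  rw [sub_pow_char_pow, map_sub, sub_eq_zero] at h
  rw [X_mul_monomial, Nat.sub_add_cancel hpos, monomial_one_right_eq_X_pow, ← h, monomial_zero_left,
    C_pow]

variable (R) in
theorem binomOp_monomial (P : binomAlgebra p k) (i : ℕ) (c : k) (h : P.1 (X ^ i) = c • X ^ i)
    (r : R) : (binomOp p k R P).1 (monomial i r) = monomial i (c • r) := by
  change baseChangeEnd R P.1 (monomial i r) = _
  rw [baseChangeEnd_monomial, h, smul_eq_C_mul, Polynomial.map_mul, map_C, Polynomial.map_pow, map_X,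
    ← mul_assoc, ← C_mul, C_mul_X_pow_eq_monomial, mul_comm, Algebra.smul_def]

variable (R) in
theorem binomOp_idem_monomial (e a i : ℕ) (r : R) :
    (binomOp p k R (idem p k e a)).1 (monomial i r) =
      if p ^ e ∣ i + 1 + a then monomial i r else 0 := by
  rw [binomOp_monomial p k R _ _ _ (idem_apply p k e a i)]
  split_ifs <;> simp

theorem euler_mem_powLinear {j e : ℕ} (h : j < e) :
    (baseChange k R (euler p k j)).1 ∈ powLinear k R[X] (p ^ e) := by
  refine mem_powLinear_of_mem_diffOpLT p (n := p ^ j + 1) ?_ ?_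
  · exact (Nat.succ_le_of_lt (Nat.pow_lt_pow_right (Fact.out : p.Prime).one_lt h))
  · exact baseChange_mem (mul_lmul_mem_diffOpLT (hasseDeriv_mem k _) _)

theorem map_list_prod_mem {k A B : Type*} [CommRing k] [Ring A] [Algebra k A] [Ring B] [Algebra k B]
    (φ : A →ₐ[k] B) (S : Subalgebra k B) {e : ℕ} (b : Fin e → A) (n : Fin e → ℕ) (m : ℕ)
    (h : ∀ j, φ (b j) ∈ S) : φ (List.ofFn fun j => 1 - (b j - (n j : A)) ^ m).prod ∈ S := by
  rw [map_list_prod]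
  refine list_prod_mem fun u hu => ?_
  obtain ⟨v, hv, rfl⟩ := List.mem_map.1 hu
  obtain ⟨j, rfl⟩ := List.mem_ofFn.1 hv
  rw [map_sub, map_pow, map_sub, map_one, map_natCast]
  exact sub_mem (one_mem _) (pow_mem (sub_mem (h j) (natCast_mem _ _)) _)

theorem binomOp_binom (e : ℕ) : (binomOp p k R (binom p k e)).1 = -(baseChange k R (euler p k e)).1 :=
  map_neg ((diffOp k R[X]).val.comp (baseChange k R)) (euler p k e)

theorem binomOp_idem_mem_powLinear (e a : ℕ) :
    (binomOp p k R (idem p k e a)).1 ∈ powLinear k R[X] (p ^ e) := by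
  refine map_list_prod_mem (A := binomAlgebra p k) ((diffOp k R[X]).val.comp (binomOp p k R))
    (powLinear k R[X] (p ^ e)) (fun j : Fin e => binom p k j) (fun j => a / p ^ (j : ℕ)) (p - 1) ?_
  intro j
  change (binomOp p k R (binom p k j)).1 ∈ _
  rw [binomOp_binom]
  exact neg_mem (euler_mem_powLinear (R := R) p k j.2)

/-- The operators in `D_R[ν_e]` preserve the grading by powers of `t`. -/
theorem exists_monomial_apply {Q : diffOp k R[X]} (hQ : Q ∈ eulerDiffOp p k R) (i : ℕ) :
    ∃ T : Module.End k R, ∀ r, Q.1 (monomial i r) = monomial i (T r) := by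
  induction hQ using Algebra.adjoin_induction with
  | mem Q hQ =>
    rcases hQ with ⟨P, rfl⟩ | ⟨e, rfl⟩
    · exact ⟨P.1, coeffEnd_monomial P.1 i⟩
    · refine ⟨((i + p ^ e).choose (p ^ e) : k) • LinearMap.id, fun r => ?_⟩
      change baseChangeEnd R (euler p k e).1 (monomial i r) = _
      rw [baseChangeEnd_monomial, ← monomial_one_right_eq_X_pow, euler_monomial, mul_one, map_monomial,
        C_mul_monomial, LinearMap.smul_apply, LinearMap.id_apply, Algebra.smul_def, mul_comm]
  | algebraMap c =>
    refine ⟨algebraMap k _ c, fun r => ?_⟩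
    change c • monomial i r = _
    rw [smul_monomial]; rfl
  | add Q Q' _ _ h h' =>
    obtain ⟨T, hT⟩ := h
    obtain ⟨T', hT'⟩ := h'
    refine ⟨T + T', fun r => ?_⟩
    rw [LinearMap.add_apply, map_add, ← hT, ← hT']; rfl
  | mul Q Q' _ _ h h' =>
    obtain ⟨T, hT⟩ := h
    obtain ⟨T', hT'⟩ := h'
    refine ⟨T * T', fun r => ?_⟩
    rw [Module.End.mul_apply, ← hT, ← hT']; rfl

/-- The idempotent of p^e - 1 - i projects δ onto its component in degree i. -/
theorem frac_mem_M {e i : ℕ} (hi : i < p ^ e) :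
    frac k f (p ^ e) (monomial i (f ^ (p ^ e - 1 - i))) ∈ M p k f := by
  refine ⟨binomOp p k R (idem p k e (p ^ e - 1 - i)), binomOp_mem p k R _, ?_⟩
  change act p k f _ (delta k f) = _
  rw [delta_eq_sum p k f e, map_sum, Finset.sum_eq_single i]
  · rw [act_frac p k f (binomOp_idem_mem_powLinear p k e _), binomOp_idem_monomial, if_pos]
    have : i + 1 + (p ^ e - 1 - i) = p ^ e := by omega
    rw [this]
  · intro j hj hne
    have hj := Finset.mem_range.1 hj
    rw [act_frac p k f (binomOp_idem_mem_powLinear p k e _), binomOp_idem_monomial, if_neg, map_zero]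
    rintro ⟨c, hc⟩
    -- The sum in `hc` is p^e + j - i, strictly between 0 and 2 p^e, so c = 1 and j = i.
    have hc2 : c < 2 := by
      by_contra h2
      have : p ^ e * 2 ≤ p ^ e * c := Nat.mul_le_mul_left _ (by omega)
      omega
    interval_cases c <;> omega
  · intro h
    exact absurd (Finset.mem_range.2 hi) h

theorem coeffEnd_X_mul (P : Module.End k R) (g : R[X]) : coeffEnd P (X * g) = X * coeffEnd P g := by
  ext i
  rcases i with _ | i
  · rw [coeff_coeffEnd, coeff_X_mul_zero, coeff_X_mul_zero, map_zero]
  · rw [coeff_coeffEnd, coeff_X_mul, coeff_X_mul, coeff_coeffEnd]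

theorem coeffOp_mul_X (P : diffOp k R) :
    coeffOp P * mulOp k (X : R[X]) = mulOp k X * coeffOp P :=
  Subtype.ext (LinearMap.ext fun g => coeffEnd_X_mul k P.1 g)

/-- Multiplying the component of δ in degree i - 1 by t gives t^i f^(p^e - i); for i = 0 the
component in degree p^e - 1 is used through `X_mul_frac`. The operator T can be applied afterwards
because it commutes with t. -/
theorem frac_mem_tM [Algebra.FiniteType k R] {e i : ℕ} (hi : i < p ^ e) {T : Module.End k R}
    (hT : T ∈ powLinear k R (p ^ e)) :
    frac k f (p ^ e) (monomial i (T (f ^ (p ^ e - 1 - i + 1)))) ∈ tM p k f := by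
  have hTd : T ∈ diffOp k R := powLinear_le_diffOp p e hT
  have hmem : (coeffOp ⟨T, hTd⟩ : diffOp k R[X]) ∈ eulerDiffOp p k R :=
    Algebra.subset_adjoin (Or.inl ⟨_, rfl⟩)
  obtain ⟨b, hb, h⟩ : ∃ b ∈ M p k f,
      frac k f (p ^ e) (monomial i (f ^ (p ^ e - 1 - i + 1))) = act p k f (mulOp k X) b := by
    rcases i with _ | i
    · refine ⟨_, frac_mem_M p k f (e := e) (i := p ^ e - 1) (by omega), ?_⟩
      rw [act_X_frac, Nat.sub_self, pow_zero, ← X_mul_frac, Nat.sub_zero, Nat.sub_add_cancel (by omega)]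
    · refine ⟨_, frac_mem_M p k f (e := e) (i := i) (by omega), ?_⟩
      rw [act_X_frac, X_mul_monomial]
      congr 4
      omega
  have h1 : frac k f (p ^ e) (monomial i (T (f ^ (p ^ e - 1 - i + 1)))) =
      act p k f (mulOp k X) (act p k f (coeffOp ⟨T, hTd⟩) b) := by
    rw [← coeffEnd_monomial, ← Module.End.mul_apply, ← map_mul, ← coeffOp_mul_X, map_mul,
      Module.End.mul_apply, ← h]
    exact (act_frac p k f (Q := coeffOp ⟨T, hTd⟩) (coeffEnd_mem_powLinear p hT) _).symm
  rw [h1]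
  exact Submodule.mem_map_of_mem (act_mem_M hmem hb)

/-- The idempotent leaves of Qδ only degrees i with p^e - 1 - i ≡ a modulo p^e, up to raising the
level; there the relation f^a ∈ D^(e) f^(a+1) moves the component into tM_f. -/
theorem idem_mem_affineBFunction [Algebra.FiniteType k R] {e a : ℕ} (ha : a < p ^ e)
    (h : ¬ IsJump p k f e a) : idem p k e a ∈ affineBFunction p k f := by
  obtain ⟨P, hP, hPf⟩ := not_not.1 h
  rintro _ ⟨Q, hQ, rfl⟩
  change act p k f _ (act p k f Q (delta k f)) ∈ _
  obtain ⟨n, hn⟩ := Q.2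
  -- The order of Q is arbitrary, so the level is raised until Q too acts through numerators.
  set e' := max n e with he'
  have hpos : 0 < p ^ e := pow_pos (Fact.out : p.Prime).pos e
  have hle : e ≤ e' := le_max_right _ _
  have hdvd : p ^ e ∣ p ^ e' := pow_dvd_pow p hle
  have hQl : Q.1 ∈ powLinear k R[X] (p ^ e') := mem_powLinear_of_mem_diffOpLT p
    ((le_max_left n e).trans (Nat.lt_pow_self (Fact.out : p.Prime).one_lt).le) hn
  rw [delta_eq_sum p k f e', map_sum, map_sum]
  refine Submodule.sum_mem _ fun i hi => ?_
  have hi := Finset.mem_range.1 hi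
  obtain ⟨T, hT⟩ := exists_monomial_apply p k hQ i
  have hTl : T ∈ powLinear k R (p ^ e') := by
    intro b x
    apply monomial_injective i
    rw [← hT]
    have : monomial i (b ^ p ^ e' * x) = C b ^ p ^ e' * monomial i x := by
      rw [← C_pow, C_mul_monomial]
    rw [this, hQl, hT, ← C_pow, C_mul_monomial]
  rw [act_frac p k f hQl, act_frac p k f (powLinear_mono hdvd (binomOp_idem_mem_powLinear p k e a)),
    hT, binomOp_idem_monomial]
  split_ifs with hd
  · obtain ⟨c, hc⟩ : ∃ c, p ^ e' - 1 - i = a + p ^ e * c := by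
      have h1 : p ^ e ∣ (p ^ e' - 1 - i) + (i + 1 + a) - a := by
        have : (p ^ e' - 1 - i) + (i + 1 + a) - a = p ^ e' := by omega
        rwa [this]
      have h2 : a ≡ p ^ e' - 1 - i [MOD p ^ e] := by
        have h3 : (p ^ e' - 1 - i) + (i + 1 + a) ≡ a + (i + 1 + a) [MOD p ^ e] := by
          have h4 : (p ^ e' - 1 - i) + (i + 1 + a) = p ^ e' + a := by omega
          rw [h4]
          calc p ^ e' + a ≡ 0 + a [MOD p ^ e] :=
                Nat.ModEq.add_right a ((Nat.modEq_zero_iff_dvd).2 hdvd)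
            _ = a + 0 := by ring
            _ ≡ a + (i + 1 + a) [MOD p ^ e] :=
                Nat.ModEq.add_left a ((Nat.modEq_zero_iff_dvd).2 hd).symm
        exact (Nat.ModEq.add_right_cancel' _ h3).symm
      refine ⟨(p ^ e' - 1 - i) / p ^ e, ?_⟩
      have h5 := Nat.mod_add_div (p ^ e' - 1 - i) (p ^ e)
      rw [← h2, Nat.mod_eq_of_lt ha] at h5
      exact h5.symm
    -- With the exponent equal to a + p^e c, the factor f^(p^e c) passes through P, so the relation
    -- for a holds for this exponent as well.
    have hf : P (f ^ (p ^ e' - 1 - i + 1)) = f ^ (p ^ e' - 1 - i) := by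
      have h1 : f ^ (p ^ e' - 1 - i + 1) = (f ^ c) ^ p ^ e * f ^ (a + 1) := by
        rw [hc, ← pow_mul, ← pow_add]; congr 1; ring
      rw [h1, hP, hPf, hc, ← pow_mul, ← pow_add]; congr 1; ring
    rw [← hf, ← Module.End.mul_apply]
    exact frac_mem_tM p k f hi (Subalgebra.mul_mem _ hTl (powLinear_mono hdvd hP))
  · rw [map_zero]; exact zero_mem _

end Jumps
end CharPBFunction

end

noncomputable section
namespace CharPBFunction

/-! ### Étale algebras over a polynomial ring -/

section Etale

open TensorProduct

/-- By flatness R ⊗ K embeds in the base change of R to the fraction field of P ⊗ K, which is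
unramified over a field and hence reduced. -/
theorem isReduced_tensorProduct_of_unramified (k P R K : Type u) [CommRing k] [CommRing P] [CommRing R]
    [CommRing K] [Algebra k P] [Algebra k R] [Algebra P R] [IsScalarTower k P R] [Algebra k K]
    [IsDomain (P ⊗[k] K)] [Module.Flat P R] [Algebra.FormallyUnramified P R]
    [Algebra.EssFiniteType P R] : IsReduced (R ⊗[k] K) := by
  let L := FractionRing (P ⊗[k] K)
  have hred : IsReduced (L ⊗[P] R) := Algebra.FormallyUnramified.isReduced_of_field L (L ⊗[P] R)
  let ψ : P ⊗[k] K →ₐ[P] L := IsScalarTower.toAlgHom P (P ⊗[k] K) L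
  let g : R ⊗[P] (P ⊗[k] K) →ₐ[P] R ⊗[P] L := Algebra.TensorProduct.map (AlgHom.id P R) ψ
  have hg : Function.Injective g :=
    Module.Flat.lTensor_preserves_injective_linearMap (M := R) ψ.toLinearMap
      (IsFractionRing.injective (P ⊗[k] K) L)
  have h1 : IsReduced (R ⊗[P] L) :=
    isReduced_of_injective (Algebra.TensorProduct.comm P R L) (AlgEquiv.injective _)
  have h2 : IsReduced (R ⊗[P] (P ⊗[k] K)) := isReduced_of_injective g hg
  exact isReduced_of_injective
    (Algebra.TensorProduct.cancelBaseChange k P R R K).symm (AlgEquiv.injective _)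

theorem isReduced_tensorProduct_of_etale (k R K : Type u) [Field k] [CommRing R] [Algebra k R] (n : ℕ)
    [Algebra (MvPolynomial (Fin n) k) R] [IsScalarTower k (MvPolynomial (Fin n) k) R]
    [Algebra.Etale (MvPolynomial (Fin n) k) R] [Field K] [Algebra k K] :
    IsReduced (R ⊗[k] K) := by
  have hdom : IsDomain (MvPolynomial (Fin n) k ⊗[k] K) :=
    ((Algebra.TensorProduct.comm k (MvPolynomial (Fin n) k) K).toRingEquiv.trans
      (MvPolynomial.algebraTensorAlgEquiv (σ := Fin n) k K).toRingEquiv).toMulEquiv.isDomain _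
  exact isReduced_tensorProduct_of_unramified k (MvPolynomial (Fin n) k) R K

variable {k R : Type u} [Field k] [CommRing R] [Algebra k R] {n : ℕ}
  [Algebra (MvPolynomial (Fin n) k) R] [IsScalarTower k (MvPolynomial (Fin n) k) R]
  [Algebra.Etale (MvPolynomial (Fin n) k) R]

/-- Over the algebraic closure the coefficients of a relation among the p-th powers have p-th roots,
so the relation becomes z^p = 0 with z = ∑ v_i ⊗ μ_i; reducedness gives z = 0, hence every μ_i = 0.
-/
theorem linearIndependent_pow_of_isReduced (p : ℕ) [Fact p.Prime] [CharP k p]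
    (h : IsReduced (R ⊗[k] AlgebraicClosure k)) {ι : Type*} {v : ι → R}
    (hv : LinearIndependent k v) : LinearIndependent k fun i => v i ^ p := by
  classical
  let K := AlgebraicClosure k
  rcases isEmpty_or_nonempty ι with hι | ⟨⟨i₀⟩⟩
  · exact linearIndependent_empty_type
  have hR : Nontrivial R := ⟨⟨v i₀, 0, hv.ne_zero i₀⟩⟩
  have hinj : Function.Injective (Algebra.TensorProduct.includeLeft : R →ₐ[k] R ⊗[k] K) :=
    Algebra.TensorProduct.includeLeft_injective (algebraMap k K).injective
  have : Nontrivial (R ⊗[k] K) := hinj.nontrivial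
  have := charP_of_algebra k (R ⊗[k] K) p
  obtain ⟨ρ, hρ⟩ := LinearMap.exists_leftInverse_of_injective (Finsupp.linearCombination k v)
    (LinearMap.ker_eq_bot.2 hv)
  have hρv : ∀ j, ρ (v j) = Finsupp.single j 1 := fun j => by
    have := DFunLike.congr_fun hρ (Finsupp.single j 1)
    rwa [LinearMap.comp_apply, Finsupp.linearCombination_single, one_smul, LinearMap.id_apply] at this
  rw [linearIndependent_iff']
  intro s g hg i hi
  choose μ hμ using fun i => IsAlgClosed.exists_pow_nat_eq (algebraMap k K (g i))
    (Fact.out : p.Prime).pos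
  have hz : (∑ i ∈ s, v i ⊗ₜ[k] μ i) ^ p = 0 := by
    rw [sum_pow_char]
    have : ∀ i ∈ s, (v i ⊗ₜ[k] μ i) ^ p = (g i • v i ^ p) ⊗ₜ[k] (1 : K) := by
      intro i _
      rw [Algebra.TensorProduct.tmul_pow, hμ, Algebra.algebraMap_eq_smul_one, TensorProduct.tmul_smul,
        TensorProduct.smul_tmul']
    rw [Finset.sum_congr rfl this, ← TensorProduct.sum_tmul, hg, TensorProduct.zero_tmul]
  have hz0 := pow_eq_zero_iff (Fact.out : p.Prime).ne_zero |>.1 hz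
  have hμ0 : μ i = 0 := by
    have h1 := congrArg (TensorProduct.lid k K ∘ LinearMap.rTensor K (Finsupp.lapply i ∘ₗ ρ)) hz0
    simp only [Function.comp_apply, map_sum, LinearMap.rTensor_tmul, LinearMap.comp_apply, hρv,
      Finsupp.lapply_apply, TensorProduct.lid_tmul, map_zero, Finsupp.single_apply, ite_smul, one_smul,
      zero_smul, Finset.sum_ite_eq', hi, if_true] at h1
    exact h1
  have h0 := hμ i
  rw [hμ0, zero_pow (Fact.out : p.Prime).ne_zero] at h0
  exact (map_eq_zero _).1 h0.symm

variable (k R n) in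
-- For an étale extension the differentials of R are base changed from the polynomial ring, so the
-- dx_i form a basis; the D_i are its coordinate functions.
theorem exists_derivation_of_etale : ∃ D : Fin n → Derivation k R R, ∀ i j,
    D i (algebraMap (MvPolynomial (Fin n) k) R (MvPolynomial.X j)) = if i = j then 1 else 0 := by
  let P := MvPolynomial (Fin n) k
  let b := (KaehlerDifferential.mvPolynomialBasis k (Fin n)).baseChange R
  let E := (KaehlerDifferential.tensorKaehlerEquivOfFormallyEtale k P R).symm
  refine ⟨fun i => (b.coord i ∘ₗ E.toLinearMap).compDer (KaehlerDifferential.D k R), fun i j => ?_⟩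
  have hE : E (KaehlerDifferential.D k R (algebraMap P R (.X j))) =
      1 ⊗ₜ KaehlerDifferential.D k P (.X j) :=
    KaehlerDifferential.tensorKaehlerEquivOfFormallyEtale_symm_D_algebraMap k P R _
  refine (congrArg (fun z => b.repr z i) hE).trans ?_
  rw [Module.Basis.baseChange_repr_tmul, KaehlerDifferential.mvPolynomialBasis_repr_D_X,
    Finsupp.single_apply]
  simp [eq_comm]

/-- R is finite and unramified over C, and (1 ⊗ r - r ⊗ 1)^p = 0 makes the diagonal ideal nilpotent.
Unramifiedness then forces 1 ⊗ r = r ⊗ 1, so C → R is an epimorphism, and a finite epimorphism is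
surjective. -/
theorem eq_top_of_pow_mem (p : ℕ) [Fact p.Prime] [CharP k p] [Algebra.FiniteType k R]
    (C : Subalgebra k R) (hX : ∀ i : Fin n, algebraMap (MvPolynomial (Fin n) k) R (.X i) ∈ C)
    (hp : ∀ r : R, r ^ p ∈ C) : C = ⊤ := by
  let P := MvPolynomial (Fin n) k
  rcases subsingleton_or_nontrivial R with hR | hR
  · exact Subsingleton.elim _ _
  let φ : P →ₐ[k] C := MvPolynomial.aeval fun i => ⟨_, hX i⟩
  algebraize [φ.toRingHom]
  have hφ : C.val.comp φ = IsScalarTower.toAlgHom k P R := by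
    ext i; simp [φ]; rfl
  have : IsScalarTower P C R := IsScalarTower.of_algebraMap_eq fun x => (DFunLike.congr_fun hφ x).symm
  have : Algebra.FormallyUnramified C R := Algebra.FormallyUnramified.of_restrictScalars P C R
  have : Algebra.FiniteType C R := Algebra.FiniteType.of_restrictScalars_finiteType k C R
  have : Algebra.IsIntegral C R := ⟨fun r =>
    IsIntegral.of_pow (Fact.out : p.Prime).pos (isIntegral_algebraMap (x := (⟨r ^ p, hp r⟩ : C)))⟩
  have : Module.Finite C R := Algebra.IsIntegral.finite
  have hnil : IsNilpotent (KaehlerDifferential.ideal C R) := by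
    rw [Ideal.FG.isNilpotent_iff_le_nilradical (KaehlerDifferential.ideal_fg C R),
      ← KaehlerDifferential.span_range_eq_ideal, Ideal.span_le]
    rintro _ ⟨r, rfl⟩
    refine ⟨p, ?_⟩
    rcases subsingleton_or_nontrivial (R ⊗[C] R) with h | h
    · exact Subsingleton.elim _ _
    have := charP_of_algebra k (R ⊗[C] R) p
    rw [sub_pow_char, Algebra.TensorProduct.tmul_pow, Algebra.TensorProduct.tmul_pow, one_pow]
    have : r ^ p = (⟨r ^ p, hp r⟩ : C) • (1 : R) := by
      rw [Algebra.smul_def, mul_one]; rfl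
    rw [this, TensorProduct.tmul_smul, TensorProduct.smul_tmul', sub_self]
    exact zero_mem _
  have hext : (Algebra.TensorProduct.includeLeft : R →ₐ[C] R ⊗[C] R) =
      Algebra.TensorProduct.includeRight := by
    refine Algebra.FormallyUnramified.ext _ hnil fun x => ?_
    rw [eq_comm, Ideal.Quotient.mk_eq_mk_iff_sub_mem]
    exact KaehlerDifferential.one_smul_sub_smul_one_mem_ideal C x
  have hepi : Algebra.IsEpi C R := by
    rw [Algebra.isEpi_iff_forall_one_tmul_eq]
    exact fun a => (DFunLike.congr_fun hext a).symm
  have hsurj := Algebra.isEpi_iff_surjective_algebraMap_of_finite.1 hepi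
  rw [eq_top_iff]
  rintro r -
  obtain ⟨c, rfl⟩ := hsurj r
  exact c.2

/-- After base change to the fraction field of the polynomial ring, R is finite, so f is algebraic;
a nonzero algebraic element of a domain divides a nonzero element of the base. -/
theorem exists_mul_eq_algebraMap [IsDomain R] {f : R} (hf : f ≠ 0) :
    ∃ (h : R) (g : MvPolynomial (Fin n) k), g ≠ 0 ∧ f * h = algebraMap _ R g := by
  let P := MvPolynomial (Fin n) k
  let L := FractionRing P
  have : Module.Flat P R := inferInstance
  have : Module.Finite L (L ⊗[P] R) := Algebra.FormallyUnramified.finite_of_free L (L ⊗[P] R)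
  have h1 : IsAlgebraic L ((1 : L) ⊗ₜ[P] f) := Algebra.IsAlgebraic.isAlgebraic _
  have h2 : IsAlgebraic P ((1 : L) ⊗ₜ[P] f) := (IsFractionRing.isAlgebraic_iff P L _).2 h1
  have hinj : Function.Injective (Algebra.TensorProduct.includeRight : R →ₐ[P] L ⊗[P] R) :=
    Algebra.TensorProduct.includeRight_injective (IsFractionRing.injective P L)
  have h3 : IsAlgebraic P f := (isAlgebraic_algHom_iff _ hinj).1 h2
  obtain ⟨g, hg, h, hh⟩ := h3.exists_nonzero_dvd (mem_nonZeroDivisors_of_ne_zero hf)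
  exact ⟨h, g, hg, hh.symm⟩

end Etale
end CharPBFunction

end

noncomputable section
namespace CharPBFunction

/-! ### The subalgebra generated by the `p`-th powers -/

section Twist

variable (p : ℕ) [Fact p.Prime] {k R : Type u} [Field k] [CharP k p] [CommRing R] [Algebra k R]

variable (k R) in
/-- The `k`-span of the `p`-th powers. -/
def powSpan : Submodule k R := Submodule.span k (Set.range fun r : R => r ^ p)

theorem pow_mem_powSpan (r : R) : r ^ p ∈ powSpan p k R := Submodule.subset_span ⟨r, rfl⟩

variable (k R) in
/-- The subalgebra generated by the `p`-th powers. -/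
def powAlgebra : Subalgebra k R := (powSpan p k R).toSubalgebra
  (by simpa using pow_mem_powSpan (k := k) p (1 : R))
  (by
    intro x y hx hy
    induction hx using Submodule.span_induction with
    | zero => rw [zero_mul]; exact zero_mem _
    | add a b _ _ ha hb => rw [add_mul]; exact add_mem ha hb
    | smul c a _ ha => rw [smul_mul_assoc]; exact Submodule.smul_mem _ c ha
    | mem a ha =>
      obtain ⟨r, rfl⟩ := ha
      induction hy using Submodule.span_induction with
      | zero => rw [mul_zero]; exact zero_mem _
      | add a b _ _ ha hb => rw [mul_add]; exact add_mem ha hb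
      | smul c a _ ha => rw [mul_smul_comm]; exact Submodule.smul_mem _ c ha
      | mem b hb =>
        obtain ⟨s, rfl⟩ := hb
        simp only [← mul_pow]
        exact pow_mem_powSpan p _)

variable (k R) in
/-- The `p`-th powers of the elements of a basis are linearly independent. -/
def PowIndep : Prop :=
  LinearIndependent k fun i => (Module.Basis.ofVectorSpace k R i) ^ p

variable {p}

theorem PowIndep.exists_dual (h : PowIndep p k R) : ∃ ρ : R →ₗ[k] (_ →₀ k),
    ∀ i, ρ ((Module.Basis.ofVectorSpace k R i) ^ p) = Finsupp.single i 1 := by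
  obtain ⟨ρ, hρ⟩ := LinearMap.exists_leftInverse_of_injective
    (Finsupp.linearCombination k fun i => (Module.Basis.ofVectorSpace k R i) ^ p)
    (LinearMap.ker_eq_bot.2 h)
  refine ⟨ρ, fun j => ?_⟩
  have := DFunLike.congr_fun hρ (Finsupp.single j 1)
  rwa [LinearMap.comp_apply, Finsupp.linearCombination_single, one_smul, LinearMap.id_apply] at this

variable [Nontrivial R]

theorem pow_eq_sum (s : R) : s ^ p = ((Module.Basis.ofVectorSpace k R).repr s).sum
    fun i c => c ^ p • (Module.Basis.ofVectorSpace k R i) ^ p := by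
  have := charP_of_algebra k R p
  conv_lhs => rw [← (Module.Basis.ofVectorSpace k R).linearCombination_repr s,
    Finsupp.linearCombination_apply, Finsupp.sum, sum_pow_char]
  exact Finset.sum_congr rfl fun i _ => _root_.smul_pow _ _ _

/-- The Frobenius twist of an operator. -/
theorem PowIndep.exists_twist (h : PowIndep p k R) (P : Module.End k R) :
    ∃ T : Module.End k R, ∀ s, T (s ^ p) = P s ^ p := by
  have := charP_of_algebra k R p
  obtain ⟨ρ, hρ⟩ := h.exists_dual
  -- By independence T may be prescribed on the p-th powers of the basis; both sides are
  -- Frobenius-semilinear in s, so agreement there suffices.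
  refine ⟨Finsupp.linearCombination k (fun i => P (Module.Basis.ofVectorSpace k R i) ^ p) ∘ₗ ρ,
    fun s => ?_⟩
  rw [pow_eq_sum (k := k), Finsupp.sum, map_sum]
  conv_rhs => rw [← (Module.Basis.ofVectorSpace k R).linearCombination_repr s,
    Finsupp.linearCombination_apply, Finsupp.sum, map_sum, sum_pow_char]
  refine Finset.sum_congr rfl fun i _ => ?_
  rw [map_smul, map_smul, LinearMap.comp_apply, hρ, Finsupp.linearCombination_single, one_smul,
    _root_.smul_pow]

variable (p k) in
/-- An additive retraction of the Frobenius of a field. -/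
theorem exists_frobenius_retraction : ∃ τ : k →+ k, (∀ a b, τ (a ^ p * b) = a * τ b) ∧ τ 1 = 1 := by
  let F := (frobenius k p).fieldRange
  -- A linear projection of k onto its subfield of p-th powers, to be followed by the p-th root.
  obtain ⟨r, hr⟩ := LinearMap.exists_leftInverse_of_injective (Algebra.linearMap F k)
    (LinearMap.ker_eq_bot.2 (algebraMap F k).injective)
  have hroot : ∀ y : F, ∃ x : k, x ^ p = y := fun y => y.2
  choose root hroot using hroot
  have hinj : ∀ x y : k, x ^ p = y ^ p → x = y := fun x y h => frobenius_inj k p h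
  have h1 : r 1 = 1 := by
    have := DFunLike.congr_fun hr 1
    simpa using this
  refine ⟨AddMonoidHom.mk' (fun x => root (r x)) fun x y => hinj _ _ ?_, fun a b => hinj _ _ ?_,
    hinj _ _ ?_⟩
  · rw [add_pow_char, hroot, hroot, hroot, map_add]; rfl
  · have : r (a ^ p * b) = (⟨a ^ p, a, rfl⟩ : F) • r b := by
      rw [← map_smul]; rfl
    simp only [AddMonoidHom.mk'_apply]
    rw [mul_pow, hroot, hroot, this]; rfl
  · simp only [AddMonoidHom.mk'_apply]
    rw [hroot, h1, one_pow]; rfl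

/-- An additive left inverse of the Frobenius, linear over Frobenius on the algebra generated by the
`p`-th powers. -/
theorem PowIndep.exists_untwist (h : PowIndep p k R) :
    ∃ σ : R →+ R, (∀ a, ∀ y ∈ powSpan p k R, σ (a ^ p * y) = a * σ y) ∧ σ 1 = 1 := by
  obtain ⟨ρ, hρ⟩ := h.exists_dual
  obtain ⟨τ, hτ, hτ1⟩ := exists_frobenius_retraction p k
  let b := Module.Basis.ofVectorSpace k R
  -- The map sends c b_i^p to τ(c) b_i: the retraction τ replaces the p-th root of c, which need not
  -- exist in k.
  let σ : R →+ R := ((Finsupp.linearCombination k b).toAddMonoidHom.comp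
    (Finsupp.mapRange.addMonoidHom τ)).comp ρ.toAddMonoidHom
  have hσb : ∀ (c : k) i, σ (c • b i ^ p) = τ c • b i := by
    intro c i
    change Finsupp.linearCombination k b (Finsupp.mapRange τ τ.map_zero (ρ (c • b i ^ p))) = _
    rw [map_smul, hρ, Finsupp.smul_single, smul_eq_mul, mul_one, Finsupp.mapRange_single,
      Finsupp.linearCombination_single]
  have hσ : ∀ (c : k) (s : R), σ (c • s ^ p) = τ c • s := by
    intro c s
    rw [pow_eq_sum (k := k), Finsupp.sum, Finset.smul_sum, map_sum]
    conv_rhs => rw [← b.linearCombination_repr s, Finsupp.linearCombination_apply, Finsupp.sum,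
      Finset.smul_sum]
    refine Finset.sum_congr rfl fun i _ => ?_
    rw [smul_smul, hσb, smul_smul, mul_comm c, hτ, mul_comm]
  refine ⟨σ, fun a y hy => ?_, ?_⟩
  · induction hy using Submodule.closure_induction with
    | zero => rw [mul_zero, map_zero, mul_zero]
    | add x y _ _ hx hy => rw [mul_add, map_add, map_add, hx, hy, mul_add]
    | smul_mem c y hy =>
      obtain ⟨s, rfl⟩ := hy
      simp only
      rw [mul_smul_comm, ← mul_pow, hσ, hσ, mul_smul_comm]
  · have := hσ 1 1
    rwa [one_pow, one_smul, hτ1, one_smul] at this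

end Twist

/-! ### Independence of coordinate monomials over the `p`-th powers -/

section Coordinates

variable {p : ℕ} [Fact p.Prime] {k R : Type u} [Field k] [CharP k p] [CommRing R] [Algebra k R]
  [Nontrivial R]

theorem derivation_powSpan (D : Derivation k R R) {c : R} (hc : c ∈ powSpan p k R) : D c = 0 := by
  have := charP_of_algebra k R p
  induction hc using Submodule.span_induction with
  | zero => exact map_zero D
  | add a b _ _ ha hb => rw [map_add, ha, hb, add_zero]
  | smul c a _ ha => rw [D.map_smul, ha, smul_zero]
  | mem a ha =>
    obtain ⟨r, rfl⟩ := ha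
    simp only [Derivation.leibniz_pow]
    rw [← Nat.cast_smul_eq_nsmul R, CharP.cast_eq_zero, zero_smul]

theorem derivation_aeval {n : ℕ} (x : Fin n → R) (D : Fin n → Derivation k R R)
    (hD : ∀ i j, D i (x j) = if i = j then 1 else 0) (i : Fin n)
    (g : MvPolynomial (Fin n) (powAlgebra p k R)) :
    D i (MvPolynomial.aeval x g) = MvPolynomial.aeval x (MvPolynomial.pderiv i g) := by
  induction g using MvPolynomial.induction_on with
  | C c =>
    rw [MvPolynomial.aeval_C, MvPolynomial.pderiv_C, map_zero]
    exact derivation_powSpan (p := p) (D i) c.2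
  | add g h hg hh => rw [map_add, map_add, hg, hh, map_add, map_add]
  | mul_X g j hg =>
    rw [map_mul, MvPolynomial.aeval_X, Derivation.leibniz, hg, hD, MvPolynomial.pderiv_mul, map_add,
      map_mul, map_mul, MvPolynomial.aeval_X, MvPolynomial.pderiv_X, smul_eq_mul, smul_eq_mul,
      Pi.single_apply]
    simp only [eq_comm (a := j)]
    split_ifs <;> simp <;> ring

theorem natCast_mul_eq_zero {S : Type*} [CommRing S] [Algebra k S] {m : ℕ} (h0 : m ≠ 0) (hm : m < p)
    {c : S} (h : c * (m : S) = 0) : c = 0 := by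
  have hu : IsUnit (m : S) := by
    rw [← map_natCast (algebraMap k S)]
    refine (IsUnit.mk0 _ fun h1 => ?_).map _
    exact absurd (Nat.le_of_dvd (Nat.pos_of_ne_zero h0) ((CharP.cast_eq_zero_iff k p m).1 h1))
      (not_le.2 hm)
  exact (hu.mul_left_eq_zero).1 h

/-- A derivation D_i kills the p-th powers and turns a relation into one of lower degree. Since
exponents are below p, differentiation multiplies each coefficient involving x_i by a unit, so
nothing but the constant term can be lost. -/
theorem eq_zero_of_aeval_eq_zero {n : ℕ} (x : Fin n → R) (D : Fin n → Derivation k R R)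
    (hD : ∀ i j, D i (x j) = if i = j then 1 else 0) (d : ℕ) :
    ∀ g : MvPolynomial (Fin n) (powAlgebra p k R),
      (∀ m, g.coeff m ≠ 0 → m.degree ≤ d ∧ ∀ i, m i < p) → MvPolynomial.aeval x g = 0 → g = 0 := by
  have hC : ∀ g : MvPolynomial (Fin n) (powAlgebra p k R), (∀ m, m ≠ 0 → g.coeff m = 0) →
      MvPolynomial.aeval x g = 0 → g = 0 := by
    intro g hg h
    have h1 : g = MvPolynomial.C (g.coeff 0) := by
      ext1 m
      rw [MvPolynomial.coeff_C]
      split_ifs with h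
      · rw [h]
      · exact hg m (Ne.symm h)
    rw [h1, MvPolynomial.aeval_C] at h
    have h2 : g.coeff 0 = 0 := Subtype.ext h
    rw [h1, h2, map_zero]
  induction d with
  | zero =>
    intro g hg h
    refine hC g (fun m hm => ?_) h
    by_contra hne
    exact hm ((Finsupp.degree_eq_zero_iff m).1 (Nat.le_zero.1 (hg m hne).1))
  | succ d ih =>
    intro g hg h
    refine hC g (fun m hm => ?_) h
    obtain ⟨i, hi⟩ := DFunLike.ne_iff.1 hm
    rw [Finsupp.coe_zero, Pi.zero_apply] at hi
    by_contra hne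
    have hle : Finsupp.single i 1 ≤ m := by
      rw [Finsupp.single_le_iff]; omega
    have h1 : MvPolynomial.pderiv i g = 0 := by
      refine ih _ (fun m' hm' => ?_) ?_
      · rw [MvPolynomial.coeff_pderiv] at hm'
        obtain ⟨h2, h3⟩ := hg _ (left_ne_zero_of_mul hm')
        rw [map_add, Finsupp.degree_single] at h2
        refine ⟨by omega, fun j => ?_⟩
        have := h3 j
        rw [Finsupp.add_apply] at this
        omega
      · rw [← derivation_aeval x D hD, h, map_zero]
    have h2 := MvPolynomial.coeff_pderiv (i := i) g (m - Finsupp.single i 1)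
    rw [h1, MvPolynomial.coeff_zero, tsub_add_cancel_of_le hle, Finsupp.tsub_apply,
      Finsupp.single_eq_same] at h2
    have h3 : ((m i - 1 : ℕ) : powAlgebra p k R) + 1 = ((m i : ℕ) : powAlgebra p k R) := by
      rw [← Nat.cast_add_one, Nat.sub_add_cancel (by omega)]
    rw [h3] at h2
    exact hne (natCast_mul_eq_zero (k := k) hi ((hg m hne).2 i) h2.symm)

end Coordinates
end CharPBFunction

end

noncomputable section
namespace CharPBFunction

/-! ### Monomial bases over the algebra generated by the `p`-th powers -/

section CoordSystem

variable {p : ℕ} [Fact p.Prime] {k R : Type u} [Field k] [CharP k p] [CommRing R] [Algebra k R]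
  {n : ℕ}

/-- The monomial in `x` with exponents `a`. -/
def mon {ι : Type*} [Fintype ι] (x : ι → R) (a : ι → ℕ) : R := ∏ i, x i ^ a i

theorem mon_add {ι : Type*} [Fintype ι] (x : ι → R) (a b : ι → ℕ) :
    mon x (a + b) = mon x a * mon x b := by
  rw [mon, mon, mon, ← Finset.prod_mul_distrib]
  exact Finset.prod_congr rfl fun i _ => pow_add _ _ _

theorem mon_zero {ι : Type*} [Fintype ι] (x : ι → R) : mon x 0 = 1 := by simp [mon]

theorem mon_single {ι : Type*} [Fintype ι] [DecidableEq ι] (x : ι → R) (i : ι) :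
    mon x (Pi.single i 1) = x i := by
  rw [mon, Finset.prod_eq_single i]
  · simp
  · intro j _ hj; simp [hj]
  · intro h; exact absurd (Finset.mem_univ i) h

theorem mon_eq_pow_mul {ι : Type*} [Fintype ι] (q : ℕ) (x : ι → R) (a : ι → ℕ) :
    mon x a = mon x (fun i => a i / q) ^ q * mon x (fun i => a i % q) := by
  rw [mon, mon, mon, ← Finset.prod_pow, ← Finset.prod_mul_distrib]
  refine Finset.prod_congr rfl fun i _ => ?_
  rw [← pow_mul, ← pow_add]
  congr 1
  rw [mul_comm, Nat.div_add_mod]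

variable (p k) in
/-- The operators `φ a` compute the coordinates with respect to the basis of the monomials `x ^ a`,
`0 ≤ a i < p`, over the algebra generated by the `p`-th powers. -/
structure IsCoordSystem (x : Fin n → R) (φ : (Fin n → Fin p) → Module.End k R) : Prop where
  indep : PowIndep p k R
  linear : ∀ a, φ a ∈ powLinear k R p
  mem : ∀ a r, φ a r ∈ powSpan p k R
  sum : ∀ r, r = ∑ a, φ a r * mon x (fun i => a i)
  dual : ∀ a b, ∀ y ∈ powSpan p k R, φ a (y * mon x (fun i => b i)) = if a = b then y else 0

variable [Nontrivial R]

theorem linearIndependent_mon (x : Fin n → R) (D : Fin n → Derivation k R R)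
    (hD : ∀ i j, D i (x j) = if i = j then 1 else 0) :
    LinearIndependent (powAlgebra p k R) fun a : Fin n → Fin p => mon x fun i => a i := by
  classical
  rw [Fintype.linearIndependent_iff]
  intro c hc b
  let F : (Fin n → Fin p) → (Fin n →₀ ℕ) := fun a => Finsupp.equivFunOnFinite.symm fun i => a i
  have hF : Function.Injective F := by
    intro a a' h
    ext i
    exact DFunLike.congr_fun h i
  let g : MvPolynomial (Fin n) (powAlgebra p k R) := ∑ a, MvPolynomial.monomial (F a) (c a)
  have hcoeff : ∀ m, g.coeff m = ∑ a, if F a = m then c a else 0 := by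
    intro m
    simp only [g, MvPolynomial.coeff_sum, MvPolynomial.coeff_monomial]
  have hg : g = 0 := by
    refine eq_zero_of_aeval_eq_zero x D hD (n * p) g (fun m hm => ?_) ?_
    · rw [hcoeff] at hm
      obtain ⟨a, -, ha⟩ := Finset.exists_ne_zero_of_sum_ne_zero hm
      obtain ⟨rfl, -⟩ := ite_ne_right_iff.1 ha
      have hlt : ∀ i, F a i < p := fun i => (a i).2
      refine ⟨?_, hlt⟩
      rw [Finsupp.degree_eq_sum]
      calc ∑ i, F a i ≤ ∑ _i : Fin n, p := Finset.sum_le_sum fun i _ => (hlt i).le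
        _ = n * p := by simp
    · rw [← hc, map_sum]
      refine Finset.sum_congr rfl fun a _ => ?_
      rw [MvPolynomial.aeval_monomial, Algebra.smul_def, Finsupp.prod_fintype _ _ fun i => pow_zero _]
      rfl
  have h1 := hcoeff (F b)
  rw [hg, MvPolynomial.coeff_zero, Finset.sum_eq_single b] at h1
  · rw [h1, if_pos rfl]
  · intro a _ hab
    rw [if_neg (hF.ne hab)]
  · intro h; exact absurd (Finset.mem_univ b) h

/-- The products r^p x^m form a monoid whose k-span is an algebra containing the x_i and all p-th
powers, hence all of R; the part of m divisible by p is absorbed into r^p. -/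
theorem span_mon_eq_top (x : Fin n → R)
    (hx : ∀ C : Subalgebra k R, (∀ i, x i ∈ C) → (∀ r : R, r ^ p ∈ C) → C = ⊤) :
    Submodule.span (powAlgebra p k R)
      (Set.range fun a : Fin n → Fin p => mon x fun i => a i) = ⊤ := by
  classical
  set W := Submodule.span (powAlgebra p k R) (Set.range fun a : Fin n → Fin p => mon x fun i => a i)
  have hp : ∀ r s : R, s ∈ W → r ^ p * s ∈ W := fun r s hs =>
    W.smul_mem (⟨r ^ p, pow_mem_powSpan (k := k) p r⟩ : powAlgebra p k R) hs
  have hmon : ∀ m : Fin n → ℕ, mon x m ∈ W := by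
    intro m
    rw [mon_eq_pow_mul p]
    exact hp _ _ (Submodule.subset_span
      ⟨fun i => ⟨m i % p, Nat.mod_lt _ (Fact.out : p.Prime).pos⟩, rfl⟩)
  let N : Submonoid R :=
    { carrier := {z | ∃ (r : R) (m : Fin n → ℕ), z = r ^ p * mon x m}
      one_mem' := ⟨1, 0, by rw [one_pow, mon_zero, mul_one]⟩
      mul_mem' := by
        rintro _ _ ⟨r, m, rfl⟩ ⟨s, l, rfl⟩
        exact ⟨r * s, m + l, by rw [mon_add, mul_pow]; ring⟩ }
  have hC := hx (Algebra.adjoin k (N : Set R))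
    (fun i => Algebra.subset_adjoin ⟨1, Pi.single i 1, by rw [one_pow, one_mul, mon_single]⟩)
    (fun r => Algebra.subset_adjoin ⟨r, 0, by rw [mon_zero, mul_one]⟩)
  rw [eq_top_iff]
  rintro r -
  have hr : r ∈ Subalgebra.toSubmodule (Algebra.adjoin k (N : Set R)) := by
    rw [hC, Algebra.top_toSubmodule]; exact Submodule.mem_top
  rw [Algebra.adjoin_eq_span, Submonoid.closure_eq] at hr
  induction hr using Submodule.span_induction with
  | zero => exact zero_mem _
  | add a b _ _ ha hb => exact add_mem ha hb
  | smul c a _ ha =>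
    have : c • a = algebraMap k (powAlgebra p k R) c • a := by
      rw [Algebra.smul_def, Algebra.smul_def, ← IsScalarTower.algebraMap_apply]
    rw [this]
    exact W.smul_mem _ ha
  | mem z hz =>
    obtain ⟨r, m, rfl⟩ := hz
    exact hp _ _ (hmon m)

theorem exists_isCoordSystem (hI : PowIndep p k R) (x : Fin n → R) (D : Fin n → Derivation k R R)
    (hD : ∀ i j, D i (x j) = if i = j then 1 else 0)
    (hx : ∀ C : Subalgebra k R, (∀ i, x i ∈ C) → (∀ r : R, r ^ p ∈ C) → C = ⊤) :
    ∃ φ, IsCoordSystem p k x φ := by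
  classical
  let b := Module.Basis.mk (linearIndependent_mon x D hD) (span_mon_eq_top x hx).ge
  have hb : ∀ a, b a = mon x fun i => a i := fun a => Module.Basis.mk_apply _ _ a
  refine ⟨fun a => (powAlgebra p k R).val.toLinearMap ∘ₗ (b.coord a).restrictScalars k, hI,
    fun a r s => ?_, fun a r => (b.coord a r).2, fun r => ?_, fun a c y hy => ?_⟩
  · have h := (b.coord a).map_smul (⟨r ^ p, pow_mem_powSpan p r⟩ : powAlgebra p k R) s
    exact congrArg Subtype.val h
  · conv_lhs => rw [← b.sum_repr r]
    refine Finset.sum_congr rfl fun a _ => ?_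
    rw [hb]; rfl
  · have h := (b.coord a).map_smul (⟨y, hy⟩ : powAlgebra p k R) (b c)
    rw [Module.Basis.coord_apply b a (b c), b.repr_self, Finsupp.single_apply, hb] at h
    refine (congrArg Subtype.val h).trans ?_
    simp only [eq_comm (a := c)]
    split_ifs <;> simp

theorem exists_isCoordSystem_of_etale [Algebra.FiniteType k R]
    [Algebra (MvPolynomial (Fin n) k) R] [IsScalarTower k (MvPolynomial (Fin n) k) R]
    [Algebra.Etale (MvPolynomial (Fin n) k) R] :
    ∃ φ, IsCoordSystem p k (fun i => algebraMap (MvPolynomial (Fin n) k) R (.X i)) φ := by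
  obtain ⟨D, hD⟩ := exists_derivation_of_etale k R n
  exact exists_isCoordSystem
    (linearIndependent_pow_of_isReduced p (isReduced_tensorProduct_of_etale k R _ n)
      (Module.Basis.linearIndependent _)) _ D hD (eq_top_of_pow_mem p)

end CoordSystem
end CharPBFunction

end

noncomputable section
namespace CharPBFunction

/-! ### Jumps and the Frobenius -/

section OpIdeal

variable {k : Type*} [CommRing k] {R : Type*} [CommRing R] [Algebra k R]

variable (k) in
/-- The submodule generated by `g` over the operators linear over `q`-th powers. -/
def opIdeal (q : ℕ) (g : R) : Ideal R where
  carrier := {r | ∃ P ∈ powLinear k R q, P g = r}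
  add_mem' := by
    rintro _ _ ⟨P, hP, rfl⟩ ⟨Q, hQ, rfl⟩
    exact ⟨P + Q, add_mem hP hQ, rfl⟩
  zero_mem' := ⟨0, zero_mem _, rfl⟩
  smul_mem' := by
    rintro c _ ⟨P, hP, rfl⟩
    exact ⟨Algebra.lmul k R c * P, mul_mem (lmul_mem_powLinear q c) hP, rfl⟩

theorem self_mem_opIdeal (q : ℕ) (g : R) : g ∈ opIdeal k q g := ⟨1, one_mem _, rfl⟩

theorem apply_mem_opIdeal {q : ℕ} {g r : R} (hr : r ∈ opIdeal k q g) {P : Module.End k R}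
    (hP : P ∈ powLinear k R q) : P r ∈ opIdeal k q g := by
  obtain ⟨Q, hQ, rfl⟩ := hr
  exact ⟨P * Q, mul_mem hP hQ, rfl⟩

theorem opIdeal_le {q : ℕ} {g r : R} (hr : r ∈ opIdeal k q g) : opIdeal k q r ≤ opIdeal k q g := by
  rintro _ ⟨P, hP, rfl⟩
  exact apply_mem_opIdeal hr hP

theorem opIdeal_pow_le (q : ℕ) (f : R) {m m' : ℕ} (h : m ≤ m') :
    opIdeal k q (f ^ m') ≤ opIdeal k q (f ^ m) := by
  refine opIdeal_le ?_
  rw [← Nat.sub_add_cancel h, pow_add]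
  exact Ideal.mul_mem_left _ _ (self_mem_opIdeal q _)

/-- An operator showing that the residue is no jump commutes with the remaining factor of f^m, a `p
^ e`-th power, and so shows that m is no jump. -/
theorem isJump_mod {p : ℕ} {f : R} {e m : ℕ} (h : IsJump p k f (e + 1) m) :
    IsJump p k f e (m % p ^ e) := by
  rintro ⟨P, hP, hf⟩
  refine h ⟨P, powLinear_mono (pow_dvd_pow p e.le_succ) hP, ?_⟩
  have h1 : ∀ j, f ^ (m + j) = (f ^ (m / p ^ e)) ^ p ^ e * f ^ (m % p ^ e + j) := by
    intro j
    rw [← pow_mul, ← pow_add, ← add_assoc, mul_comm, Nat.div_add_mod]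
  rw [h1, hP, hf]
  exact (h1 0).symm

end OpIdeal

/-! ### Removing and adding lowest digits of jumps -/

section FrobeniusTwist

variable {p : ℕ} [Fact p.Prime] {k R : Type u} [Field k] [CharP k p] [CommRing R] [Algebra k R]
  {n : ℕ}

variable (p) in
/-- `T` is a Frobenius twist of `P`. -/
def IsTwist (P T : Module.End k R) : Prop := ∀ s, T (s ^ p) = P s ^ p

theorem IsTwist.apply_pow_mul {P T : Module.End k R} (h : IsTwist p P T) {q : ℕ}
    (hP : P ∈ powLinear k R q) (a : R) {y : R} (hy : y ∈ powSpan p k R) :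
    T ((a ^ q) ^ p * y) = (a ^ q) ^ p * T y := by
  induction hy using Submodule.span_induction with
  | zero => rw [mul_zero, map_zero, mul_zero]
  | add x y _ _ hx hy => rw [mul_add, map_add, hx, hy, map_add, mul_add]
  | smul c x _ hx => rw [mul_smul_comm, map_smul, hx, map_smul, mul_smul_comm]
  | mem x hx =>
    obtain ⟨s, rfl⟩ := hx
    simp only
    rw [← mul_pow, h, hP, mul_pow, h]

/-- A twist is controlled only on the span of the p-th powers; preceding it by an operator with
values there gives linearity on all of R. -/
theorem IsTwist.mul_mem {P T Q : Module.End k R} (h : IsTwist p P T) {e : ℕ}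
    (hP : P ∈ powLinear k R (p ^ e)) (hQ : Q ∈ powLinear k R p)
    (hQ' : ∀ r, Q r ∈ powSpan p k R) : T * Q ∈ powLinear k R (p ^ (e + 1)) := by
  intro a x
  rw [Module.End.mul_apply, Module.End.mul_apply, pow_succ, pow_mul, hQ,
    h.apply_pow_mul hP a (hQ' x)]

variable (p n) in
/-- The exponent `0`. -/
def zeroIdx : Fin n → Fin p := fun _ => ⟨0, (Fact.out : p.Prime).pos⟩

variable [Nontrivial R] {x : Fin n → R} {φ : (Fin n → Fin p) → Module.End k R}

theorem IsCoordSystem.zeroIdx_apply (h : IsCoordSystem p k x φ) {y : R}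
    (hy : y ∈ powSpan p k R) : φ (zeroIdx p n) y = y := by
  have h1 := h.dual (zeroIdx p n) (zeroIdx p n) y hy
  have h2 : mon x (fun i => ((zeroIdx p n i : Fin p) : ℕ)) = 1 := mon_zero x
  rwa [h2, mul_one, if_pos rfl] at h1

/-- With m' = m / p, the twist of P sends f^(p(m'+1)) to f^(p m'). Multiplying by powers of f before
and after adjusts these exponents to m + 1 and m. -/
theorem IsCoordSystem.isJump_div (h : IsCoordSystem p k x φ) {f : R} {e m : ℕ}
    (hm : IsJump p k f (e + 1) m) : IsJump p k f e (m / p) := by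
  rintro ⟨P, hP, hf⟩
  obtain ⟨T, hT⟩ := h.indep.exists_twist P
  have hlt : m % p < p := Nat.mod_lt _ (Fact.out : p.Prime).pos
  have hdm := Nat.div_add_mod m p
  refine hm ⟨Algebra.lmul k R (f ^ (m % p)) *
      ((T * φ (zeroIdx p n)) * Algebra.lmul k R (f ^ (p - 1 - m % p))),
    mul_mem (lmul_mem_powLinear _ _) (mul_mem
      (IsTwist.mul_mem hT hP (h.linear _) (h.mem _)) (lmul_mem_powLinear _ _)), ?_⟩
  have h1 : f ^ (p - 1 - m % p) * f ^ (m + 1) = (f ^ (m / p + 1)) ^ p := by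
    rw [← pow_add, ← pow_mul]
    congr 1
    rw [add_mul, one_mul, mul_comm (m / p)]
    omega
  change f ^ (m % p) * T (φ (zeroIdx p n) (f ^ (p - 1 - m % p) * f ^ (m + 1))) = f ^ m
  rw [h1, h.zeroIdx_apply (pow_mem_powSpan p _), hT, hf, ← pow_mul, ← pow_add]
  congr 1
  rw [mul_comm (m / p)]
  omega

/-- If no digit worked, the relations for c = 0, …, p - 1 would chain to f^(pm) ∈ D^(e+1) f^(pm+p).
Composing the operator with Frobenius on the right, and with the zeroth coordinate and the untwist σ
on the left, would give an operator of level e sending f^(m+1) to f^m. -/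
theorem IsCoordSystem.exists_isJump (h : IsCoordSystem p k x φ) {f : R} {e m : ℕ}
    (hm : IsJump p k f e m) : ∃ c < p, IsJump p k f (e + 1) (p * m + c) := by
  by_contra! hc
  have key : ∀ c ≤ p, f ^ (p * m) ∈ opIdeal k (p ^ (e + 1)) (f ^ (p * m + c)) := by
    intro c hcp
    induction c with
    | zero => exact self_mem_opIdeal _ _
    | succ c ih =>
      exact opIdeal_le (not_not.1 (hc c (by omega))) (ih (by omega))
  obtain ⟨P, hP, hf⟩ := key p le_rfl
  obtain ⟨σ, hσ, hσ1⟩ := h.indep.exists_untwist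
  have hQ : ∀ a s : R, σ (φ (zeroIdx p n) (P (a ^ p ^ (e + 1) * s))) =
      a ^ p ^ e * σ (φ (zeroIdx p n) (P s)) := by
    intro a s
    rw [hP, pow_succ, pow_mul, h.linear, hσ _ _ (h.mem _ _)]
  let Q : Module.End k R :=
    { toFun := fun s => σ (φ (zeroIdx p n) (P (s ^ p)))
      map_add' := by
        intro s t
        have := charP_of_algebra k R p
        rw [add_pow_char, map_add, map_add, map_add]
      map_smul' := by
        intro c s
        rw [_root_.smul_pow, map_smul, map_smul, Algebra.smul_def, map_pow, hσ _ _ (h.mem _ _),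
          RingHom.id_apply, Algebra.smul_def] }
  refine hm ⟨Q, fun a s => ?_, ?_⟩
  · change σ (φ (zeroIdx p n) (P ((a ^ p ^ e * s) ^ p))) = _ * σ (φ (zeroIdx p n) (P (s ^ p)))
    rw [mul_pow, ← pow_mul, ← pow_succ, hQ]
  · change σ (φ (zeroIdx p n) (P ((f ^ (m + 1)) ^ p))) = _
    have h1 : (f ^ (m + 1)) ^ p = f ^ (p * m + p) := by
      rw [← pow_mul]; congr 1; ring
    have h2 := hσ (f ^ m) 1 (by simpa using pow_mem_powSpan (k := k) p (1 : R))
    rw [mul_one, hσ1, mul_one] at h2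
    rw [h1, hf, mul_comm p m, pow_mul, h.zeroIdx_apply (pow_mem_powSpan p _), h2]

/-- Induction on digits: a coordinate operator selects the lowest digits of the exponents, and the
twist of the dual operator one level below selects the others. -/
theorem IsCoordSystem.exists_dual (h : IsCoordSystem p k x φ) (e : ℕ) :
    ∀ m : Fin n → ℕ, (∀ i, m i < p ^ e) → ∃ ψ ∈ powLinear k R (p ^ e),
      ∀ l : Fin n → ℕ, (∀ i, l i < p ^ e) → ψ (mon x l) = if m = l then 1 else 0 := by
  have hpp := (Fact.out : p.Prime).pos
  induction e with
  | zero =>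
    intro m hm
    refine ⟨1, one_mem _, fun l hl => ?_⟩
    have hz : ∀ m : Fin n → ℕ, (∀ i, m i < p ^ 0) → m = 0 := by
      intro m hm
      ext i
      simpa using hm i
    rw [hz m hm, hz l hl, if_pos rfl, mon_zero]; rfl
  | succ e ih =>
    intro m hm
    obtain ⟨ψ, hψ, hd⟩ := ih (fun i => m i / p) fun i => Nat.div_lt_of_lt_mul (by
      rw [mul_comm, ← pow_succ]; exact hm i)
    obtain ⟨T, hT⟩ := h.indep.exists_twist ψ
    let a : (Fin n → ℕ) → (Fin n → Fin p) := fun l i => ⟨l i % p, Nat.mod_lt _ hpp⟩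
    refine ⟨T * φ (a m), IsTwist.mul_mem hT hψ (h.linear _) (h.mem _), fun l hl => ?_⟩
    have h1 := h.dual (a m) (a l) _ (pow_mem_powSpan p (mon x fun i => l i / p))
    rw [mon_eq_pow_mul p, Module.End.mul_apply]
    refine (congrArg T h1).trans ?_
    have hiff : m = l ↔ a m = a l ∧ (fun i => m i / p) = fun i => l i / p := by
      constructor
      · rintro rfl; exact ⟨rfl, rfl⟩
      · rintro ⟨h2, h3⟩
        ext i
        have h4 : m i % p = l i % p := congrArg Fin.val (congrFun h2 i)
        have h5 : m i / p = l i / p := congrFun h3 i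
        rw [← Nat.div_add_mod (m i) p, ← Nat.div_add_mod (l i) p, h4, h5]
    by_cases h2 : a m = a l
    · rw [if_pos h2, hT, hd _ fun i => Nat.div_lt_of_lt_mul (by
        rw [mul_comm, ← pow_succ]; exact hl i)]
      by_cases h3 : (fun i => m i / p) = fun i => l i / p
      · rw [if_pos h3, if_pos (hiff.2 ⟨h2, h3⟩), one_pow]
      · rw [if_neg h3, if_neg fun h => h3 (hiff.1 h).2, zero_pow hpp.ne']
    · rw [if_neg h2, map_zero, if_neg fun h => h2 (hiff.1 h).1]

/-- At a level e with all exponents of g below p^e, the operator dual to a monomial of g sends g to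
its nonzero coefficient. As g is a multiple of f, this gives 1 ∈ D^(e) f. -/
theorem IsCoordSystem.exists_not_isJump_zero (h : IsCoordSystem p k x φ) {f b : R}
    {g : MvPolynomial (Fin n) k} (hg : g ≠ 0) (hfg : f * b = MvPolynomial.aeval x g) :
    ∃ e, ¬ IsJump p k f e 0 := by
  obtain ⟨m, hm⟩ := MvPolynomial.ne_zero_iff.1 hg
  let e := g.totalDegree
  have hlt : ∀ l ∈ g.support, ∀ i, l i < p ^ e := fun l hl i =>
    lt_of_le_of_lt ((MvPolynomial.le_degreeOf_of_mem_support i hl).trans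
      (MvPolynomial.degreeOf_le_totalDegree g i)) (Nat.lt_pow_self (Fact.out : p.Prime).one_lt)
  have hms : m ∈ g.support := MvPolynomial.mem_support_iff.2 hm
  obtain ⟨ψ, hψ, hd⟩ := h.exists_dual e m (hlt m hms)
  refine ⟨e, not_not.2 ⟨(g.coeff m)⁻¹ • (ψ * Algebra.lmul k R b),
    Subalgebra.smul_mem _ (mul_mem hψ (lmul_mem_powLinear _ _)) _, ?_⟩⟩
  change (g.coeff m)⁻¹ • ψ (b * f ^ (0 + 1)) = f ^ 0
  have h1 : ψ (MvPolynomial.aeval x g) = g.coeff m • 1 := by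
    rw [MvPolynomial.aeval_def, MvPolynomial.eval₂_eq', map_sum, Finset.sum_eq_single m]
    · rw [← Algebra.smul_def, map_smul]
      refine congrArg _ ((hd m (hlt m hms)).trans (if_pos rfl))
    · intro l hl hne
      rw [← Algebra.smul_def, map_smul]
      refine (congrArg _ ((hd l (hlt l hl)).trans (if_neg fun h => hne ?_))).trans (smul_zero _)
      exact DFunLike.coe_injective h.symm
    · intro h; exact absurd hms h
  rw [zero_add, pow_one, mul_comm, hfg, h1, smul_smul, inv_mul_cancel₀ hm, one_smul, pow_zero]

end FrobeniusTwist
end CharPBFunction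

end

noncomputable section
namespace CharPBFunction

/-! ### Boundedness of the number of jumps -/

section Filtration

variable (p : ℕ) [Fact p.Prime] {k R : Type u} [Field k] [CharP k p] [CommRing R] [Algebra k R]
  {ι : Type*} [Fintype ι] (y : ι → R)

/-- The exponents `≤ D`. -/
def expLE (ι : Type*) [Fintype ι] (D : ℕ) : Set (ι → ℕ) := {β | ∀ i, β i ≤ D}

variable (k) in
/-- The span of the `p ^ e`-th powers of the monomials in `y` with exponents `≤ D`. -/
def filtPow (e D : ℕ) : Submodule k R :=
  Submodule.span k ((fun β => mon y β ^ p ^ e) '' expLE ι D)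

theorem filtPow_mono (e : ℕ) {D D' : ℕ} (h : D ≤ D') : filtPow p k y e D ≤ filtPow p k y e D' :=
  Submodule.span_mono (Set.image_mono fun _ hβ i => (hβ i).trans h)

theorem mul_mem_filtPow {e D D' : ℕ} {r s : R} (hr : r ∈ filtPow p k y e D)
    (hs : s ∈ filtPow p k y e D') : r * s ∈ filtPow p k y e (D + D') := by
  have h := Submodule.mul_mem_mul hr hs
  rw [filtPow, filtPow, Submodule.span_mul_span] at h
  refine Submodule.span_mono ?_ h
  rintro _ ⟨_, ⟨β, hβ, rfl⟩, _, ⟨γ, hγ, rfl⟩, rfl⟩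
  exact ⟨β + γ, fun i => add_le_add (hβ i) (hγ i), by simp only [mon_add, mul_pow]⟩

theorem one_mem_filtPow (e D : ℕ) : (1 : R) ∈ filtPow p k y e D :=
  Submodule.subset_span ⟨0, fun _ => Nat.zero_le D, by simp only [mon_zero, one_pow]⟩

theorem pow_mem_filtPow {e D : ℕ} {r : R} (hr : r ∈ filtPow p k y e D) (l : ℕ) :
    r ^ l ∈ filtPow p k y e (l * D) := by
  induction l with
  | zero => rw [pow_zero]; exact one_mem_filtPow p y e _
  | succ l ih =>
    rw [pow_succ, add_mul, one_mul]
    exact mul_mem_filtPow p y ih hr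

theorem exists_mem_filtPow (hy : Algebra.adjoin k (Set.range y) = ⊤) (r : R) :
    ∃ D, r ∈ filtPow p k y 0 D := by
  classical
  have hr : r ∈ Algebra.adjoin k (Set.range y) := hy ▸ Algebra.mem_top
  induction hr using Algebra.adjoin_induction with
  | mem z hz =>
    obtain ⟨i, rfl⟩ := hz
    refine ⟨1, Submodule.subset_span ⟨Pi.single i 1, fun j => ?_, ?_⟩⟩
    · rw [Pi.single_apply]; split_ifs <;> simp
    · simp only [mon_single, pow_zero, pow_one]
  | algebraMap c =>
    rw [Algebra.algebraMap_eq_smul_one]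
    exact ⟨0, Submodule.smul_mem _ c (one_mem_filtPow p y 0 0)⟩
  | add a b _ _ ha hb =>
    obtain ⟨D, ha⟩ := ha
    obtain ⟨D', hb⟩ := hb
    exact ⟨max D D', add_mem (filtPow_mono p y 0 (le_max_left _ _) ha)
      (filtPow_mono p y 0 (le_max_right _ _) hb)⟩
  | mul a b _ _ ha hb =>
    obtain ⟨D, ha⟩ := ha
    obtain ⟨D', hb⟩ := hb
    exact ⟨D + D', mul_mem_filtPow p y ha hb⟩

variable (ι) in
/-- The finite set of the exponents `≤ D`. -/
def expFinset (D : ℕ) : Finset (ι → ℕ) := by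
  classical exact Fintype.piFinset fun _ => Finset.range (D + 1)

theorem coe_expFinset (D : ℕ) : (expFinset ι D : Set (ι → ℕ)) = expLE ι D := by
  ext β
  simp [expFinset, expLE]

/-- The dimension of `filtPow p k y e D` is bounded by the number of exponents ≤ D, whatever e is.
-/
theorem card_le_of_linearIndepOn {e D : ℕ} {κ : Type*} {v : κ → R} {T : Finset κ}
    (hv : LinearIndepOn k v (T : Set κ)) (hT : ∀ m ∈ T, v m ∈ filtPow p k y e D) :
    T.card ≤ (expFinset ι D).card := by
  classical
  have hV : filtPow p k y e D =
      Submodule.span k (((expFinset ι D).image fun β => mon y β ^ p ^ e : Finset R) : Set R) := by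
    rw [Finset.coe_image, coe_expFinset, filtPow]
  have h1 := finrank_span_eq_card hv
  rw [show Fintype.card (T : Set κ) = T.card by simp] at h1
  rw [← h1]
  have : FiniteDimensional k (filtPow p k y e D) := by
    rw [hV]; infer_instance
  have h2 : Submodule.span k (Set.range fun m : T => v m) ≤ filtPow p k y e D := by
    rw [Submodule.span_le]
    rintro _ ⟨m, rfl⟩
    exact hT m m.2
  refine (Submodule.finrank_mono h2).trans ?_
  rw [hV]
  exact (finrank_span_finset_le_card _).trans Finset.card_image_le

variable [Nontrivial R]

theorem pow_char_mem_filtPow {e D : ℕ} {r : R} (hr : r ∈ filtPow p k y e D) :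
    r ^ p ∈ filtPow p k y (e + 1) D := by
  have := charP_of_algebra k R p
  induction hr using Submodule.span_induction with
  | zero => rw [zero_pow (Fact.out : p.Prime).ne_zero]; exact zero_mem _
  | add a b _ _ ha hb => rw [add_pow_char]; exact add_mem ha hb
  | smul c a _ ha => rw [_root_.smul_pow]; exact Submodule.smul_mem _ _ ha
  | mem a ha =>
    obtain ⟨β, hβ, rfl⟩ := ha
    exact Submodule.subset_span ⟨β, hβ, by simp only [pow_succ, pow_mul]⟩

theorem exists_mem_filtPow_one (hy : Algebra.adjoin k (Set.range y) = ⊤) {r : R}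
    (hr : r ∈ powSpan p k R) : ∃ D, r ∈ filtPow p k y 1 D := by
  induction hr using Submodule.span_induction with
  | zero => exact ⟨0, zero_mem _⟩
  | add a b _ _ ha hb =>
    obtain ⟨D, ha⟩ := ha
    obtain ⟨D', hb⟩ := hb
    exact ⟨max D D', add_mem (filtPow_mono p y 1 (le_max_left _ _) ha)
      (filtPow_mono p y 1 (le_max_right _ _) hb)⟩
  | smul c a _ ha =>
    obtain ⟨D, ha⟩ := ha
    exact ⟨D, Submodule.smul_mem _ c ha⟩
  | mem a ha =>
    obtain ⟨s, rfl⟩ := ha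
    obtain ⟨D, hs⟩ := exists_mem_filtPow p y hy s
    exact ⟨D, pow_char_mem_filtPow p y hs⟩

variable {p y} {n : ℕ} {x : Fin n → R} {φ : (Fin n → Fin p) → Module.End k R}

/-- Linearity over p-th powers pulls out the quotients of the exponents by p; only finitely many
monomials with exponents below p remain, and K bounds their contribution. -/
theorem IsCoordSystem.exists_filtPow (h : IsCoordSystem p k x φ)
    (hy : Algebra.adjoin k (Set.range y) = ⊤) :
    ∃ K, ∀ D, ∀ r ∈ filtPow p k y 0 D, ∀ a, φ a r ∈ filtPow p k y 1 (D / p + K) := by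
  classical
  have hpp := (Fact.out : p.Prime).pos
  have h1 : ∀ aγ : (Fin n → Fin p) × (ι → Fin p),
      ∃ D, φ aγ.1 (mon y fun i => aγ.2 i) ∈ filtPow p k y 1 D :=
    fun aγ => exists_mem_filtPow_one p y hy (h.mem _ _)
  choose d hd using h1
  refine ⟨Finset.univ.sup d, fun D r hr a => ?_⟩
  induction hr using Submodule.span_induction with
  | zero => rw [map_zero]; exact zero_mem _
  | add a b _ _ ha hb => rw [map_add]; exact add_mem ha hb
  | smul c a _ ha => rw [map_smul]; exact Submodule.smul_mem _ _ ha
  | mem z hz =>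
    obtain ⟨β, hβ, rfl⟩ := hz
    simp only [pow_zero, pow_one]
    rw [mon_eq_pow_mul p, h.linear]
    refine mul_mem_filtPow p y (Submodule.subset_span
      ⟨fun i => β i / p, fun i => Nat.div_le_div_right (hβ i), by simp only [pow_one]⟩) ?_
    let aγ : (Fin n → Fin p) × (ι → Fin p) := (a, fun i => ⟨β i % p, Nat.mod_lt _ hpp⟩)
    exact filtPow_mono p y 1 (Finset.le_sup (Finset.mem_univ aγ)) (hd aγ)

theorem IsTwist.mem_filtPow {P T : Module.End k R} (hT : IsTwist p P T) {e D D' : ℕ}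
    (hP : ∀ r ∈ filtPow p k y 0 D, P r ∈ filtPow p k y e D') {z : R}
    (hz : z ∈ filtPow p k y 1 D) : T z ∈ filtPow p k y (e + 1) D' := by
  induction hz using Submodule.span_induction with
  | zero => rw [map_zero]; exact zero_mem _
  | add a b _ _ ha hb => rw [map_add]; exact add_mem ha hb
  | smul c a _ ha => rw [map_smul]; exact Submodule.smul_mem _ _ ha
  | mem z hz =>
    obtain ⟨β, hβ, rfl⟩ := hz
    simp only [pow_one]
    rw [hT]
    exact pow_char_mem_filtPow p y (hP _ (Submodule.subset_span
      ⟨β, hβ, by simp only [pow_zero, pow_one]⟩))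

/-- Coordinates over the `p ^ e`-th powers, with bounds for the degrees independent of `e`. -/
theorem IsCoordSystem.exists_coordinates (h : IsCoordSystem p k x φ)
    (hy : Algebra.adjoin k (Set.range y) = ⊤) :
    ∃ K, ∀ e, ∃ (κ : Type) (_ : Fintype κ) (Φ : κ → Module.End k R) (v : κ → R),
      (∀ i, Φ i ∈ powLinear k R (p ^ e)) ∧ (∀ r, r = ∑ i, Φ i r * v i) ∧
      ∀ b, ∀ r ∈ filtPow p k y 0 (p ^ e * b + K), ∀ i, Φ i r ∈ filtPow p k y e (b + K) := by
  have := charP_of_algebra k R p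
  have hp2 := (Fact.out : p.Prime).two_le
  obtain ⟨K, hK⟩ := h.exists_filtPow hy
  -- The constant 2K is stable under the recursion: 2K / p + K ≤ 2K because p ≥ 2.
  refine ⟨2 * K, fun e => ?_⟩
  induction e with
  | zero =>
    refine ⟨Unit, inferInstance, fun _ => 1, fun _ => 1, fun _ => one_mem _, fun r => by simp,
      fun b r hr _ => ?_⟩
    rwa [pow_zero, one_mul] at hr
  | succ e ih =>
    obtain ⟨κ, _, Φ, v, hΦ, hsum, hdeg⟩ := ih
    choose T hT using fun i => h.indep.exists_twist (Φ i)
    -- Coordinates one level up: take coordinates over the p-th powers, then the twists of the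
    -- previous coordinates.
    refine ⟨(Fin n → Fin p) × κ, inferInstance, fun ai => T ai.2 * φ ai.1,
      fun ai => mon x (fun j => ai.1 j) * v ai.2 ^ p,
      fun ai => IsTwist.mul_mem (hT ai.2) (hΦ _) (h.linear _) (h.mem _), fun r => ?_,
      fun b r hr ai => ?_⟩
    · have hz : ∀ z ∈ powSpan p k R, z = ∑ i, T i z * v i ^ p := by
        intro z hz
        induction hz using Submodule.span_induction with
        | zero => simp
        | add a b _ _ ha hb =>
          conv_lhs => rw [ha, hb]
          simp only [map_add, add_mul, Finset.sum_add_distrib]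
        | smul c a _ ha =>
          conv_lhs => rw [ha]
          simp only [map_smul, smul_mul_assoc, Finset.smul_sum]
        | mem z hz =>
          obtain ⟨s, rfl⟩ := hz
          simp only [hT]
          conv_lhs => rw [hsum s]
          rw [sum_pow_char]
          simp only [mul_pow]
      conv_lhs => rw [h.sum r]
      rw [Fintype.sum_prod_type]
      refine Finset.sum_congr rfl fun a _ => ?_
      conv_lhs => rw [hz _ (h.mem a r), Finset.sum_mul]
      refine Finset.sum_congr rfl fun i _ => ?_
      rw [Module.End.mul_apply]; ring
    · refine IsTwist.mem_filtPow (hT ai.2) (fun s hs => hdeg b s hs ai.2) ?_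
      refine filtPow_mono p y 1 ?_ (hK _ r hr ai.1)
      have h1 : (p ^ (e + 1) * b + 2 * K) / p = p ^ e * b + 2 * K / p := by
        rw [pow_succ', mul_assoc, Nat.mul_add_div (by omega)]
      have h2 : 2 * K / p ≤ K := Nat.div_le_of_le_mul (by nlinarith)
      omega

/-- Triangularity: `O a` for the smallest index a contains all later vectors but not v a. -/
theorem linearIndepOn_of_notMem {κ V : Type*} [LinearOrder κ] [AddCommGroup V] [Module k V]
    (v : κ → V) (O : κ → Submodule k V) (T : Finset κ) (hO : ∀ m ∈ T, v m ∉ O m)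
    (hv : ∀ m ∈ T, ∀ l ∈ T, m < l → v l ∈ O m) : LinearIndepOn k v (T : Set κ) := by
  classical
  induction T using Finset.induction_on_min with
  | empty => simp
  | insert a s hs ih =>
    rw [Finset.coe_insert]
    refine LinearIndepOn.insert (ih (fun m hm => hO m (Finset.mem_insert_of_mem hm))
      fun m hm l hl => hv m (Finset.mem_insert_of_mem hm) l (Finset.mem_insert_of_mem hl)) ?_
    intro hmem
    refine hO a (Finset.mem_insert_self a s) (Submodule.span_le.2 ?_ hmem)
    rintro _ ⟨l, hl, rfl⟩
    exact hv a (Finset.mem_insert_self a s) l (Finset.mem_insert_of_mem hl) (hs l hl)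

/-- The number of jumps is bounded independently of the level. -/
theorem IsCoordSystem.exists_card_le (h : IsCoordSystem p k x φ) [Algebra.FiniteType k R] (f : R) :
    ∃ N, ∀ e (T : Finset ℕ), (∀ m ∈ T, m < p ^ e ∧ IsJump p k f e m) → T.card ≤ N := by
  obtain ⟨S, hS⟩ := (inferInstance : Algebra.FiniteType k R).out
  let y : S → R := fun i => i
  have hy : Algebra.adjoin k (Set.range y) = ⊤ := by
    rw [← hS]; congr 1; simp [y]
  obtain ⟨b, hb⟩ := exists_mem_filtPow p y hy f
  obtain ⟨K, hK⟩ := h.exists_coordinates hy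
  refine ⟨(expFinset S (b + K)).card, fun e T hT => ?_⟩
  obtain ⟨κ, _, Φ, v, hΦ, hsum, hdeg⟩ := hK e
  -- If all coordinates of f^m lay in the ideal D^(e) f^(m+1), so would f^m, and m would not be a
  -- jump. The chosen coordinates are independent because those of f^l lie in that ideal for l > m.
  have hex : ∀ m, ∃ i, m ∈ T → Φ i (f ^ m) ∉ opIdeal k (p ^ e) (f ^ (m + 1)) := by
    intro m
    by_cases hm : m ∈ T
    · by_contra! hc
      refine (hT m hm).2 ?_
      change f ^ m ∈ opIdeal k (p ^ e) (f ^ (m + 1))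
      rw [hsum (f ^ m)]
      exact Ideal.sum_mem _ fun i _ => Ideal.mul_mem_right _ _ (hc i).2
    · rcases isEmpty_or_nonempty κ with hκ | ⟨⟨i⟩⟩
      · exact absurd (hsum 1) (by simp)
      · exact ⟨i, fun h => absurd h hm⟩
  choose i hi using hex
  refine card_le_of_linearIndepOn p y (e := e) (D := b + K) (v := fun m => Φ (i m) (f ^ m))
    (linearIndepOn_of_notMem _
      (fun m => (opIdeal k (p ^ e) (f ^ (m + 1))).restrictScalars k) T hi fun m _ l _ hml => ?_)
    fun m hm => hdeg b _ ?_ _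
  · exact opIdeal_pow_le _ f hml (apply_mem_opIdeal (self_mem_opIdeal _ _) (hΦ _))
  · refine filtPow_mono p y 0 ?_ (pow_mem_filtPow p y hb m)
    exact (Nat.mul_le_mul_right b (hT m hm).1.le).trans (Nat.le_add_right _ _)

end Filtration

/-! ### Rationality in an étale chart -/

section EtaleCoordinates

/-- A `p`-adic integer all of whose truncations are jumps of `f` is rational. -/
theorem exists_rat_of_isJump {p : ℕ} [Fact p.Prime] {k R : Type u} [Field k] [CharP k p]
    [CommRing R] [IsDomain R] [Algebra k R] [Algebra.FiniteType k R] (n : ℕ)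
    [Algebra (MvPolynomial (Fin n) k) R] [IsScalarTower k (MvPolynomial (Fin n) k) R]
    [Algebra.Etale (MvPolynomial (Fin n) k) R] {f : R} (hf : f ≠ 0) {α : ℤ_[p]}
    (hα : ∀ e, IsJump p k f e (α.appr e)) : ∃ q : ℚ, (α : ℚ_[p]) = q ∧ -1 ≤ q ∧ q < 0 := by
  obtain ⟨φ, h⟩ := exists_isCoordSystem_of_etale (p := p) (k := k) (R := R) (n := n)
  obtain ⟨N, hN⟩ := h.exists_card_le f
  obtain ⟨d, hd, a, ha, h1⟩ := exists_eq_add_pow_mul (fun e => {m | IsJump p k f e m}) N hN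
    (fun _ _ => isJump_mod) (fun _ _ => h.isJump_div) (fun _ _ => h.exists_isJump) α hα
  refine exists_rat_of_eq_add_pow_mul ?_ hd ha h1
  rintro rfl
  obtain ⟨b, g, hg, hfg⟩ := exists_mul_eq_algebraMap (k := k) (n := n) hf
  rw [show algebraMap (MvPolynomial (Fin n) k) R g =
    MvPolynomial.aeval (fun i => algebraMap (MvPolynomial (Fin n) k) R (.X i)) g from
    DFunLike.congr_fun (MvPolynomial.aeval_unique
      (IsScalarTower.toAlgHom k (MvPolynomial (Fin n) k) R)) g] at hfg
  obtain ⟨e, he⟩ := h.exists_not_isJump_zero hg hfg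
  refine he ?_
  have h0 : (0 : ℤ_[p]).appr e = 0 :=
    appr_eq_of_dvd (pow_pos (Fact.out : p.Prime).pos e) (y := 0) (by simp)
  have := hα e
  rwa [h0] at this

end EtaleCoordinates
end CharPBFunction

end

noncomputable section
namespace CharPBFunction

/-! ### Jumps and localization -/

section LocalizationJumps

variable {k R : Type*} [CommRing k] [CommRing R] [Algebra k R]

/-- A `q`-th power linear operator extends to a `q`-th power linear operator on a localization. -/
theorem exists_extends_mem_powLinear {L : Type*} [CommRing L] [Algebra R L] [Algebra k L]
    [IsScalarTower k R L] (s : R) [IsLocalization.Away s L] {q : ℕ} (hq : 0 < q)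
    {P : Module.End k R} (hP : P ∈ powLinear k R q) :
    ∃ Q ∈ powLinear k L q, Extends P Q := by
  obtain ⟨Q, hPQ, hQ⟩ := exists_extends_of_linear (L := L) s q hq P hP
  have hQ' : ∀ m x, Q (algebraMap R L s ^ (q * m) * x) = algebraMap R L s ^ (q * m) * Q x := by
    intro m
    induction m with
    | zero => simp
    | succ m ih =>
      intro x
      rw [mul_add, mul_one, pow_add, mul_assoc, ih, hQ, mul_assoc]
  refine ⟨Q, fun b x => ?_, hPQ⟩
  obtain ⟨m, a, ha⟩ := exists_mul_pow_eq s q hq x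
  obtain ⟨m', b', hb⟩ := exists_mul_pow_eq s 1 one_pos b
  rw [one_mul] at hb
  have h1 : algebraMap R L s ^ (q * (m + m')) * (b ^ q * x) = algebraMap R L (b' ^ q * a) := by
    rw [map_mul, map_pow, ← ha, ← hb]; ring
  have h2 : algebraMap R L s ^ (q * m) * x = algebraMap R L a := by rw [mul_comm, ha]
  apply (isUnit_algebraMap_pow (L := L) s (q * (m + m'))).mul_left_cancel
  rw [← hQ', h1, hPQ, hP, map_mul, ← hPQ, ← h2, hQ', map_pow, ← hb]
  ring

theorem not_isJump_of_isLocalization {p : ℕ} [Fact p.Prime] {L : Type*} [CommRing L] [Algebra R L]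
    [Algebra k L] [IsScalarTower k R L] (s : R) [IsLocalization.Away s L] {f : R} {e m : ℕ}
    (h : ¬ IsJump p k f e m) : ¬ IsJump p k (algebraMap R L f) e m := by
  obtain ⟨P, hP, hf⟩ := not_not.1 h
  obtain ⟨Q, hQ, hPQ⟩ := exists_extends_mem_powLinear (L := L) s
    (pow_pos (Fact.out : p.Prime).pos e) hP
  exact not_not.2 ⟨Q, hQ, by rw [← map_pow, hPQ, hf, map_pow]⟩

/-- Denominators of power linear operators can be cleared on algebras of finite type. -/
theorem exists_pow_mul_apply_eq [Algebra.FiniteType k R] {L : Type*} [CommRing L] [Algebra R L]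
    [Algebra k L] [IsScalarTower k R L] (s : R) [IsLocalization.Away s L] {q : ℕ} (hq : 0 < q)
    {P : Module.End k L} (hP : P ∈ powLinear k L q) :
    ∃ N, ∀ r : R, ∃ r' : R, algebraMap R L s ^ N * P (algebraMap R L r) = algebraMap R L r' := by
  classical
  obtain ⟨S, hS⟩ := (inferInstance : Algebra.FiniteType k R).out
  let y : S → R := fun i => i
  have h1 : ∀ γ : S → Fin q, ∃ (N : ℕ) (r' : R),
      P (algebraMap R L (mon y fun i => γ i)) * algebraMap R L s ^ (1 * N) = algebraMap R L r' :=
    fun γ => exists_mul_pow_eq s 1 one_pos _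
  choose N r' hr' using h1
  simp only [one_mul] at hr'
  let M := Finset.univ.sup N
  -- The elements for which s^M clears the denominator. A monomial splits as a q-th power, which P
  -- lets through, times one of the finitely many monomials with exponents below q, for which M was
  -- chosen.
  let W : Submodule k R := (LinearMap.range (IsScalarTower.toAlgHom k R L).toLinearMap).comap
    ((Algebra.lmul k L (algebraMap R L s ^ M) * P) ∘ₗ (IsScalarTower.toAlgHom k R L).toLinearMap)
  have hW : ∀ r, r ∈ W ↔ ∃ r', algebraMap R L r' = algebraMap R L s ^ M * P (algebraMap R L r) :=
    fun r => Iff.rfl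
  have hmon : ∀ β : S → ℕ, mon y β ∈ W := by
    intro β
    let γ : S → Fin q := fun i => ⟨β i % q, Nat.mod_lt _ hq⟩
    have hγ : N γ ≤ M := Finset.le_sup (Finset.mem_univ γ)
    refine (hW _).2 ⟨mon y (fun i => β i / q) ^ q * (s ^ (M - N γ) * r' γ), ?_⟩
    rw [mon_eq_pow_mul q y β, map_mul (algebraMap R L) _ (mon y fun i => β i % q), map_pow, hP,
      map_mul, map_mul, ← hr', map_pow, map_pow]
    have h2 : algebraMap R L s ^ M = algebraMap R L s ^ (M - N γ) * algebraMap R L s ^ N γ := by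
      rw [← pow_add, Nat.sub_add_cancel hγ]
    rw [h2]
    ring
  refine ⟨M, fun r => ?_⟩
  suffices r ∈ W by
    obtain ⟨r', h⟩ := (hW r).1 this
    exact ⟨r', h.symm⟩
  let Y : Submonoid R :=
    { carrier := Set.range (mon y)
      one_mem' := ⟨0, mon_zero y⟩
      mul_mem' := by
        rintro _ _ ⟨β, rfl⟩ ⟨γ, rfl⟩
        exact ⟨β + γ, mon_add y β γ⟩ }
  have hle : Algebra.adjoin k (S : Set R) ≤ Algebra.adjoin k (Y : Set R) := by
    refine Algebra.adjoin_mono fun z hz => ⟨Pi.single ⟨z, hz⟩ 1, mon_single y _⟩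
  have hr : r ∈ Subalgebra.toSubmodule (Algebra.adjoin k (Y : Set R)) := hle (hS ▸ Algebra.mem_top)
  rw [Algebra.adjoin_eq_span, Submonoid.closure_eq] at hr
  refine Submodule.span_le.2 ?_ hr
  rintro _ ⟨β, rfl⟩
  exact hmon β

/-- For s ≠ 0 the ring R embeds in L, and s^N P preserves R for large N, so it restricts to an
operator on R sending g to s^N h. -/
theorem exists_pow_mul_mem_opIdeal [IsDomain R] [Algebra.FiniteType k R] {L : Type*} [CommRing L]
    [Algebra R L] [Algebra k L] [IsScalarTower k R L] (s : R) [IsLocalization.Away s L] {q : ℕ}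
    (hq : 0 < q) {g h : R} (hgh : algebraMap R L h ∈ opIdeal k q (algebraMap R L g)) :
    ∃ N, s ^ N * h ∈ opIdeal k q g := by
  rcases eq_or_ne s 0 with rfl | hs
  · exact ⟨1, by simp⟩
  have hinj : Function.Injective (algebraMap R L) :=
    IsLocalization.injective L (powers_le_nonZeroDivisors_of_noZeroDivisors hs)
  obtain ⟨P, hP, hPg⟩ := hgh
  obtain ⟨N, hN⟩ := exists_pow_mul_apply_eq s hq hP
  choose F hF using hN
  let Q : Module.End k R :=
    { toFun := F
      map_add' := by
        intro x y
        apply hinj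
        rw [map_add, ← hF, ← hF, ← hF, map_add, map_add, mul_add]
      map_smul' := by
        intro c x
        apply hinj
        rw [RingHom.id_apply, algebraMap_smul_eq, ← hF, ← hF, algebraMap_smul_eq, map_smul,
          mul_smul_comm] }
  refine ⟨N, Q, fun a x => hinj ?_, hinj ?_⟩
  · change algebraMap R L (F _) = algebraMap R L (_ * F _)
    rw [map_mul, ← hF, ← hF, map_mul, map_pow, hP]; ring
  · change algebraMap R L (F _) = _
    rw [← hF, hPg, map_mul, map_pow]

end LocalizationJumps
end CharPBFunction

end

noncomputable section
namespace CharPBFunction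

/-! ### Jumps on schemes -/

section SchemeJumps

variable {k : Type u} [Field k] {X : Scheme.{u}} (π : X ⟶ Spec (.of k))

theorem map_comp_scalars {U V : X.Opens} (i : V ⟶ U) :
    (X.presheaf.map i.op).hom.comp (scalars π U) = scalars π V := by
  rw [scalars, scalars, ← CommRingCat.hom_comp, Category.assoc]
  exact congrArg (fun t => ((Scheme.ΓSpecIso (.of k)).inv ≫ t).hom)
    (Scheme.Hom.appLE_map π (U := ⊤) le_top i.op)

theorem finiteType_scalars [Smooth π] {U : X.Opens} (hU : IsAffineOpen U) :
    (scalars π U).FiniteType := by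
  have h1 : (π.appLE ⊤ U le_top).hom.FiniteType :=
    RingHom.FiniteType.of_finitePresentation
      (Scheme.Hom.smooth_appLE π (isAffineOpen_top _) hU le_top).finitePresentation
  rw [scalars, CommRingCat.hom_comp]
  exact h1.comp (RingHom.FiniteType.of_surjective _
    (ConcreteCategory.bijective_of_isIso (Scheme.ΓSpecIso (.of k)).inv).2)

theorem exists_isStandardSmooth_scalars [Smooth π] (x : X) :
    ∃ V : X.affineOpens, x ∈ V.1 ∧ (scalars π V.1).IsStandardSmooth := by
  obtain ⟨U, hU, V, hV, hx, e, h⟩ := Smooth.exists_isStandardSmooth π x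
  -- The base has a single point.
  obtain rfl : U = ⊤ := by
    have : Subsingleton (Spec (.of k)) := inferInstanceAs (Subsingleton (PrimeSpectrum k))
    rw [eq_top_iff]
    intro z _
    rw [Subsingleton.elim z (π x)]
    exact e hx
  refine ⟨⟨V, hV⟩, hx, ?_⟩
  exact RingHom.isStandardSmooth_respectsIso.2 _ (Scheme.ΓSpecIso (.of k)).symm.commRingCatIsoToRingEquiv h

variable (p : ℕ) (f : Γ(X, ⊤))

/-- The restriction of a function to an open subset. -/
abbrev restrict (U : X.Opens) : Γ(X, U) := X.presheaf.map (homOfLE (le_top : U ≤ ⊤)).op f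

theorem map_restrict {U V : X.Opens} (i : V ⟶ U) :
    X.presheaf.map i.op (restrict f U) = restrict f V := by
  rw [restrict, ← CommRingCat.comp_apply, ← X.presheaf.map_comp]
  rfl

/-- Jumps of the restriction of `f` to `U`. -/
def IsJumpOn (U : X.Opens) (e m : ℕ) : Prop :=
  letI : Algebra k Γ(X, U) := (scalars π U).toAlgebra
  IsJump p k (restrict f U) e m

theorem not_isJumpOn_basicOpen [Fact p.Prime] {e m : ℕ} {U : X.Opens} (hU : IsAffineOpen U)
    (s : Γ(X, U)) (h : ¬ IsJumpOn π p f U e m) : ¬ IsJumpOn π p f (X.basicOpen s) e m := by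
  let _ : Algebra k Γ(X, U) := (scalars π U).toAlgebra
  let _ : Algebra k Γ(X, X.basicOpen s) := (scalars π (X.basicOpen s)).toAlgebra
  have : IsLocalization.Away s Γ(X, X.basicOpen s) := hU.isLocalization_basicOpen s
  have : IsScalarTower k Γ(X, U) Γ(X, X.basicOpen s) :=
    IsScalarTower.of_algebraMap_eq' (map_comp_scalars π (homOfLE (X.basicOpen_le s))).symm
  have h1 := not_isJump_of_isLocalization (L := Γ(X, X.basicOpen s)) s h
  have h2 : algebraMap Γ(X, U) Γ(X, X.basicOpen s) (restrict f U) = restrict f (X.basicOpen s) :=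
    map_restrict f (homOfLE (X.basicOpen_le s))
  rwa [h2] at h1

/-- The z with z f^m ∈ D^(e) f^(m+1) form an ideal. It contains a power of every s in S by clearing
denominators, so its radical, and hence the ideal itself, is the unit ideal. -/
theorem not_isJumpOn_of_span [Fact p.Prime] [IsIntegral X] [Smooth π] {e m : ℕ} {U : X.Opens}
    (hU : IsAffineOpen U) (S : Set Γ(X, U)) (hS : Ideal.span S = ⊤)
    (h : ∀ s ∈ S, ¬ IsJumpOn π p f (X.basicOpen s) e m) : ¬ IsJumpOn π p f U e m := by
  let _ : Algebra k Γ(X, U) := (scalars π U).toAlgebra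
  rcases isEmpty_or_nonempty U with hemp | hne
  · have : Subsingleton Γ(X, U) := by
      have : U = ⊥ := by
        ext z
        exact ⟨fun hz => hemp.elim ⟨z, hz⟩, fun hz => hz.elim⟩
      rw [this]
      infer_instance
    exact not_not.2 ⟨0, zero_mem _, Subsingleton.elim _ _⟩
  have hft : Algebra.FiniteType k Γ(X, U) := finiteType_scalars π hU
  have hq : 0 < p ^ e := pow_pos (Fact.out : p.Prime).pos e
  let F := restrict f U
  let J : Ideal Γ(X, U) := 
    Submodule.comap (LinearMap.mulRight Γ(X, U) (F ^ m)) (opIdeal k (p ^ e) (F ^ (m + 1)))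
  have hJ : ∀ z, z ∈ J ↔ z * F ^ m ∈ opIdeal k (p ^ e) (F ^ (m + 1)) := fun z => Iff.rfl
  have hrad : J.radical = ⊤ := by
    rw [eq_top_iff, ← hS, Ideal.span_le]
    intro s hs
    let _ : Algebra k Γ(X, X.basicOpen s) := (scalars π (X.basicOpen s)).toAlgebra
    have : IsLocalization.Away s Γ(X, X.basicOpen s) := hU.isLocalization_basicOpen s
    have : IsScalarTower k Γ(X, U) Γ(X, X.basicOpen s) :=
      IsScalarTower.of_algebraMap_eq' (map_comp_scalars π (homOfLE (X.basicOpen_le s))).symm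
    have h1 := not_not.1 (h s hs)
    have h2 : algebraMap Γ(X, U) Γ(X, X.basicOpen s) F = restrict f (X.basicOpen s) :=
      map_restrict f (homOfLE (X.basicOpen_le s))
    have h3 : algebraMap Γ(X, U) Γ(X, X.basicOpen s) (F ^ m) ∈
        opIdeal k (p ^ e) (algebraMap Γ(X, U) Γ(X, X.basicOpen s) (F ^ (m + 1))) := by
      rw [map_pow, map_pow, h2]
      exact h1
    obtain ⟨N, hN⟩ := exists_pow_mul_mem_opIdeal s hq h3
    exact ⟨N, (hJ _).2 hN⟩
  rw [Ideal.radical_eq_top] at hrad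
  have h1 : (1 : Γ(X, U)) ∈ J := hrad ▸ Submodule.mem_top
  rw [hJ, one_mul] at h1
  exact not_not.2 h1

/-- The absence of jumps is local. -/
theorem not_isJumpOn_of_cover [Fact p.Prime] [IsIntegral X] [Smooth π] {e m : ℕ} {ι : Type*}
    (V : ι → X.affineOpens) (hV : (⨆ i, (V i : X.Opens)) = ⊤)
    (h : ∀ i, ¬ IsJumpOn π p f (V i) e m) (U : X.affineOpens) : ¬ IsJumpOn π p f U e m :=
  of_affine_open_cover (P := fun U => ¬ IsJumpOn π p f U.1 e m) V hV U
    (fun U s hU => not_isJumpOn_basicOpen π p f U.2 s hU)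
    (fun U S hS hU => not_isJumpOn_of_span π p f U.2 S hS fun s hs => hU ⟨s, hs⟩) h

theorem exists_rat_of_isJumpOn [Fact p.Prime] [CharP k p] [IsIntegral X] [Smooth π] (hf : f ≠ 0)
    {V : X.affineOpens} (hV : (scalars π V.1).IsStandardSmooth) [Nonempty V.1] {α : ℤ_[p]}
    (hα : ∀ e, IsJumpOn π p f V.1 e (α.appr e)) : ∃ q : ℚ, (α : ℚ_[p]) = q ∧ -1 ≤ q ∧ q < 0 := by
  let _ : Algebra k Γ(X, V.1) := (scalars π V.1).toAlgebra
  have hft : Algebra.FiniteType k Γ(X, V.1) := finiteType_scalars π V.2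
  obtain ⟨n, g, hg, hge⟩ := hV.exists_etale_mvPolynomial
  let _ : Algebra (MvPolynomial (Fin n) k) Γ(X, V.1) := g.toAlgebra
  have : IsScalarTower k (MvPolynomial (Fin n) k) Γ(X, V.1) :=
    IsScalarTower.of_algebraMap_eq' hg.symm
  have : Algebra.Etale (MvPolynomial (Fin n) k) Γ(X, V.1) := hge
  refine exists_rat_of_isJump n (f := restrict f V.1) ?_ hα
  have hinj := map_injective_of_isIntegral X (homOfLE (le_top : V.1 ≤ ⊤))
  intro h0
  exact hf (hinj (h0.trans (map_zero _).symm))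

theorem exists_isJumpOn_of_mem_roots [Fact p.Prime] [CharP k p] [Smooth π] {α : ℤ_[p]}
    (hα : α ∈ roots (bFunction π p f)) (e : ℕ) :
    ∃ U : X.affineOpens, IsJumpOn π p f U.1 e (α.appr e) := by
  obtain ⟨𝔪, h𝔪, hle⟩ := hα
  have h1 : idem p k e (α.appr e) ∉ bFunction π p f := fun h => idem_notMem p k h𝔪 e (hle h)
  rw [bFunction, Submodule.mem_iInf, not_forall] at h1
  obtain ⟨U, hU⟩ := h1
  refine ⟨U, fun h => hU ?_⟩
  let _ : Algebra k Γ(X, U.1) := (scalars π U.1).toAlgebra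
  have hft : Algebra.FiniteType k Γ(X, U.1) := finiteType_scalars π U.2
  exact idem_mem_affineBFunction p k (restrict f U.1) (PadicInt.appr_lt α e) (not_not.2 h)

/-- In contrapositive form: once some truncation of α is no jump on U, no longer one is. This allows
the levels on a finite cover to be made equal. -/
theorem isJumpOn_of_le [Fact p.Prime] {α : ℤ_[p]} {U : X.Opens} {e e' : ℕ} (h : e ≤ e')
    (hj : IsJumpOn π p f U e' (α.appr e')) : IsJumpOn π p f U e (α.appr e) := by
  induction e', h using Nat.le_induction with
  | base => exact hj
  | succ e' h ih =>
    let _ : Algebra k Γ(X, U) := (scalars π U).toAlgebra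
    refine ih ?_
    have := isJump_mod hj
    rwa [appr_mod α (Nat.le_succ e')] at this

end SchemeJumps
end CharPBFunction

end

/-- The roots of the `b`-function of a nonconstant function `f` on a smooth variety `X` over a field of
characteristic `p` are negative rational numbers `≥ -1`. -/
theorem mainTheorem2 (p : ℕ) [Fact p.Prime] (k : Type u) [Field k] [CharP k p]
    (X : Scheme.{u}) (π : X ⟶ Spec (.of k)) [IsIntegral X] [IsSeparated π] [QuasiCompact π]
    [Smooth π] (f : Γ(X, ⊤)) (hf : f ∉ Set.range (CharPBFunction.scalars π ⊤))
    (α : ℤ_[p]) (hα : α ∈ CharPBFunction.roots (CharPBFunction.bFunction π p f)) :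
    ∃ q : ℚ, (α : ℚ_[p]) = (q : ℚ_[p]) ∧ -1 ≤ q ∧ q < 0 := by
  have hX : CompactSpace X := QuasiCompact.compactSpace_of_compactSpace π
  have hf0 : f ≠ 0 := by
    rintro rfl
    exact hf ⟨0, map_zero _⟩
  choose V hxV hV using CharPBFunction.exists_isStandardSmooth_scalars π
  obtain ⟨t, ht⟩ := isCompact_univ.elim_finite_subcover (fun x => ((V x).1 : Set X))
    (fun x => (V x).1.isOpen) fun x _ => Set.mem_iUnion.2 ⟨x, hxV x⟩
  have hcover : (⨆ x : t, ((V x.1).1 : X.Opens)) = ⊤ := by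
    rw [eq_top_iff]
    intro z hz
    obtain ⟨x, hx, hzx⟩ := Set.mem_iUnion₂.1 (ht (Set.mem_univ z))
    exact TopologicalSpace.Opens.mem_iSup.2 ⟨⟨x, hx⟩, hzx⟩
  obtain ⟨x, hx⟩ : ∃ x, ∀ e, CharPBFunction.IsJumpOn π p f (V x).1 e (α.appr e) := by
    -- Otherwise each chart of the finite cover has a level without jump. At the largest of these
    -- levels no chart has a jump, so by locality no affine open does, which a root forbids.
    by_contra! hc
    choose E hE using hc
    obtain ⟨U, hU⟩ := CharPBFunction.exists_isJumpOn_of_mem_roots π p f hα (t.sup E)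
    exact CharPBFunction.not_isJumpOn_of_cover π p f (fun x : t => V x.1) hcover
      (fun x h => hE x.1 (CharPBFunction.isJumpOn_of_le π p f (Finset.le_sup x.2) h)) U hU
  have : Nonempty (V x).1 := ⟨⟨x, hxV x⟩⟩
  exact CharPBFunction.exists_rat_of_isJumpOn π p f hf0 (hV x) hx
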